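/- **Setting.** Let $d,k\ge 1$ and $p\in(1,\infty)$, and let $\Omega\subset\mathbb{R}^d$ be open, connected and bounded. Let $\Omega_1,\dots,\Omega_s\subset\Omega$ satisfy $\bigcup_{\ell=1}^s\Omega_\ell=\Omega$, where each $\Omega_\ell$ is a finite union of pairwise disjoint open connected sets. Let $\chi_1,\dots,\chi_s\in C^\infty(\Omega)$ satisfy $\chi_\ell>0$ on $\Omega_\ell$, $\chi_\ell=0$ on $\Omega\setminus\Omega_\ell$ and $\sum_{\ell=1}^s\chi_\ell=1$ on $\Omega$. Let $L^p(\Omega_\ell,\chi_\ell)$ be the $L^p$ space on $\Omega_\ell$ of the measure $\chi_\ell\,dx$. Let $H$ be a real Hilbert space and $\delta:H\to\mathcal{D}'(\Omega)^k$ a linear map. Set $$V=\Bigl\{u\in H:\ \exists\, v\in L^p(\Omega)^k,\ (\delta u)_j(\phi)=\int_\Omega v_j\phi\,dx\ \ \forall \phi\in C_0^\infty(\Omega),\ j=1,\dots,k\Bigr\},$$ $$V_\ell=\Bigl\{u\in H:\ \exists\, v\in L^p(\Omega_\ell,\chi_\ell)^k,\ (\delta u)_j(\chi_\ell\phi)=\int_{\Omega_\ell}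 v_j\chi_\ell\phi\,dx\ \ \forall \phi\in C_0^\infty(\Omega),\ j=1,\dots,k\Bigr\},$$ and denote the (a.e. unique) representatives $v$ by $\delta_pu$ for $u\in V$ and by $\delta_{p,\ell}u$ for $u\in V_\ell$. For $\alpha:\Omega\times\mathbb{R}^k\to\mathbb{R}^k$ put $$\langle Fu,v\rangle=\int_\Omega\alpha(x,\delta_pu)\cdot\delta_pv\,dx\quad(u,v\in V),\qquad \langle F_\ell u,v\rangle=\int_{\Omega_\ell}\chi_\ell\,\alpha(x,\delta_{p,\ell}u)\cdot\delta_{p,\ell}v\,dx\quad(u,v\in V_\ell).$$ The Friedrich extension $f:D(f)\subseteq H\to H$ is defined by: $u\in D(f)$ and $fu=z$ if and only if $u\in V$, $z\in H$ and $\langle Fu,v\rangle=-(z,v)_H$ for all $v\in V$. The operators $f_\ell:D(f_\ell)\subseteq H\to H$ are defined in the same way from $V_\ell$ and $F_\ell$. **Assumptions.** 1. If $u_n\to u$ in $H$, then $(\delta u_n)_j(\phi)\to(\delta u)_j(\phi)$ for all $\phi\in C_0^\infty(\Omega)$ and $j=1,\dots,k$. 2. $V$ is dense in $H$. 3. $\alpha(x,\cdot)$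 is continuous for a.e. $x\in\Omega$, and $\alpha(\cdot,z)$ is measurable for every $z$. There are $c_1>0$ and a nonnegative $c_2\in L^{p/(p-1)}(\Omega)$ with $|\alpha(x,z)|\le c_1|z|^{p-1}+c_2(x)$ for a.e. $x$ and every $z$. For all $z,\tilde z$ and a.e. $x$, $(\alpha(x,z)-\alpha(x,\tilde z))\cdot(z-\tilde z)\ge 0$. There are $c_3>0$ and $c_4\in L^1(\Omega)$ with $\alpha(x,z)\cdot z\ge c_3|z|^p-c_4(x)$ for every $z$ and a.e. $x$. 4. For every $h>0$, $V\subseteq R\bigl(I-hf|_{\bigcap_{\ell=1}^sD(f_\ell)}\bigr)$. 5. $D(f)$ is dense in $H$. **Theorem.** Under Assumptions 1–5 the following hold. (a) For every $h>0$ the resolvents $(I-hf)^{-1}$ and $(I-hf_\ell)^{-1}$, $\ell=1,\dots,s$, are well defined on all of $H$: for each $v\in H$ there is exactly one $u\in D(f)$ with $u-hfu=v$, and exactly one $u\in D(f_\ell)$ with $u-hf_\ell u=v$. (b) For every $\eta\in H$ and $t>0$ the limit $e^{tf}\eta=\lim_{n\to\infty}(I-\tfrac tn f)^{-n}\eta$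 exists in $H$. (c) The Lie splitting converges to the mild solution $t\mapsto e^{tf}\eta$ (defined by the limit in (b)) of $\dot u=fu$, $u(0)=\eta$: let $P_hu=v_s$, where $v_0=u$ and $v_\ell=(I-hf_\ell)^{-1}v_{\ell-1}$ for $\ell=1,\dots,s$; then $$\lim_{n\to\infty}\ \sup_{t\in(0,T)}\bigl\|P_{t/n}^n\eta-e^{tf}\eta\bigr\|_H=0\qquad\text{for every }\eta\in H\text{ and }T<\infty.$$ -/

import Mathlib

open MeasureTheory Filter Topology TopologicalSpace Set
open scoped Distributions ContDiff InnerProductSpace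

noncomputable section

namespace DomainSplitting

/-- Decomposition of the open set `Ω` into subdomains `Ω_ℓ`, each a finite union of pairwise disjoint
open connected sets (a single one if `Ω_ℓ` itself is connected), together with a subordinate smooth
partition of unity `χ_ℓ`. Values of `χ_ℓ` outside of `Ω` play no role. -/
structure DomainDecomposition {d : ℕ} (Ω : Opens (EuclideanSpace ℝ (Fin d))) (s : ℕ) where
  sub : Fin s → Set (EuclideanSpace ℝ (Fin d))
  sub_components : ∀ ℓ, ∃ (r : ℕ) (W : Fin r → Set (EuclideanSpace ℝ (Fin d))),
    (∀ i, IsOpen (W i) ∧ IsConnected (W i)) ∧ Pairwise (fun i j => Disjoint (W i) (W j)) ∧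
      ⋃ i, W i = sub ℓ
  iUnion_sub : ⋃ ℓ, sub ℓ = (Ω : Set (EuclideanSpace ℝ (Fin d)))
  χ : Fin s → EuclideanSpace ℝ (Fin d) → ℝ
  smooth : ∀ ℓ, ContDiffOn ℝ ∞ (χ ℓ) Ω
  pos : ∀ ℓ, ∀ x ∈ sub ℓ, 0 < χ ℓ x
  zero : ∀ ℓ, ∀ x ∈ (Ω : Set (EuclideanSpace ℝ (Fin d))) \ sub ℓ, χ ℓ x = 0
  sum_eq_one : ∀ x ∈ Ω, ∑ ℓ, χ ℓ x = 1

/-- The test function `w φ`, for `w` smooth on `Ω` and `φ` a test function on `Ω`. -/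
def mulTest {d : ℕ} {Ω : Opens (EuclideanSpace ℝ (Fin d))}
    (w : EuclideanSpace ℝ (Fin d) → ℝ) (hw : ContDiffOn ℝ ∞ w Ω) (φ : 𝓓(Ω, ℝ)) : 𝓓(Ω, ℝ) where
  toFun := fun x => w x * φ x
  contDiff' := by
    rw [contDiff_iff_contDiffAt]
    intro x
    by_cases hx : x ∈ tsupport φ
    · have hxΩ : (Ω : Set (EuclideanSpace ℝ (Fin d))) ∈ 𝓝 x :=
        Ω.isOpen.mem_nhds (φ.tsupport_subset hx)
      exact (hw.contDiffAt hxΩ).mul φ.contDiff.contDiffAt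
    · have h0 : (fun x => w x * φ x) =ᶠ[𝓝 x] fun _ => (0 : ℝ) := by
        filter_upwards [(isClosed_tsupport φ).isOpen_compl.mem_nhds hx] with y hy
        rw [image_eq_zero_of_notMem_tsupport hy, mul_zero]
      exact contDiffAt_const.congr_of_eventuallyEq h0
  hasCompactSupport' := φ.hasCompactSupport.mul_left
  tsupport_subset' := (tsupport_mul_subset_right (f := w)).trans φ.tsupport_subset

/-! ### Energetic spaces and operators over a weight

All objects come in two versions, for `Ω` with Lebesgue measure and for `Ω_ℓ` with the measure
`χ_ℓ dx`. They are instances of one construction, for a measure `μ` and for linear forms `T u j` on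
test functions. -/

section Energetic

variable {d k : ℕ} {Ω : Opens (EuclideanSpace ℝ (Fin d))} {H : Type*} [NormedAddCommGroup H]
  [InnerProductSpace ℝ H]

/-- The forms `T j` on test functions are represented by the components of `v ∈ L^p(μ)^k`. -/
def RepresentedBy (μ : Measure (EuclideanSpace ℝ (Fin d))) (p : ℝ) (T : Fin k → 𝓓(Ω, ℝ) → ℝ)
    (v : EuclideanSpace ℝ (Fin d) → EuclideanSpace ℝ (Fin k)) : Prop :=
  MemLp v (ENNReal.ofReal p) μ ∧ ∀ j φ, T j φ = ∫ x, v x j * φ x ∂μ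

/-- The elements `u` of `H` for which `T u` has a representative in `L^p(μ)^k`. -/
def energySpace (μ : Measure (EuclideanSpace ℝ (Fin d))) (p : ℝ)
    (T : H → Fin k → 𝓓(Ω, ℝ) → ℝ) : Set H :=
  {u | ∃ v, RepresentedBy μ p (T u) v}

/-- The representative of `T u` in `L^p(μ)^k`, for `u` in the energetic space. -/
def density (μ : Measure (EuclideanSpace ℝ (Fin d))) (p : ℝ)
    (T : H → Fin k → 𝓓(Ω, ℝ) → ℝ) (u : H) :
    EuclideanSpace ℝ (Fin d) → EuclideanSpace ℝ (Fin k) :=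
  Classical.epsilon (RepresentedBy μ p (T u))

/-- The pairing of the energetic operator at `u` with `v`. -/
def energyForm (μ : Measure (EuclideanSpace ℝ (Fin d))) (p : ℝ)
    (T : H → Fin k → 𝓓(Ω, ℝ) → ℝ)
    (α : EuclideanSpace ℝ (Fin d) → EuclideanSpace ℝ (Fin k) → EuclideanSpace ℝ (Fin k))
    (u v : H) : ℝ :=
  ∫ x, ⟪α x (density μ p T u x), density μ p T v x⟫_ℝ ∂μ

/-- The graph of the Friedrich extension: `u` is in the energetic space, and the energetic operator
at `u` is the restriction of the bounded functional on `H` with Riesz representative `-z`. -/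
def friedrich (μ : Measure (EuclideanSpace ℝ (Fin d))) (p : ℝ)
    (T : H → Fin k → 𝓓(Ω, ℝ) → ℝ)
    (α : EuclideanSpace ℝ (Fin d) → EuclideanSpace ℝ (Fin k) → EuclideanSpace ℝ (Fin k)) :
    Set (H × H) :=
  {q | q.1 ∈ energySpace μ p T ∧ ∀ v ∈ energySpace μ p T, energyForm μ p T α q.1 v = ⟪-q.2, v⟫_ℝ}

/-- If the energetic space is dense, the Friedrich extension is single-valued. -/
theorem friedrich_unique {μ : Measure (EuclideanSpace ℝ (Fin d))} {p : ℝ}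
    {T : H → Fin k → 𝓓(Ω, ℝ) → ℝ}
    {α : EuclideanSpace ℝ (Fin d) → EuclideanSpace ℝ (Fin k) → EuclideanSpace ℝ (Fin k)}
    (hV : Dense (energySpace μ p T)) {u z z' : H} (h : (u, z) ∈ friedrich μ p T α)
    (h' : (u, z') ∈ friedrich μ p T α) : z = z' := by
  have h0 := hV.eq_of_inner_left (𝕜 := ℝ) (x := -z) (y := -z') fun v hv =>
    (h.2 v hv).symm.trans (h'.2 v hv)
  exact neg_injective h0

end Energetic

section Concrete

variable {d k s : ℕ} {Ω : Opens (EuclideanSpace ℝ (Fin d))} {H : Type*} [NormedAddCommGroup H]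
  [InnerProductSpace ℝ H]

/-- The measure `χ_ℓ dx` on `Ω_ℓ`, so that `L^p(Ω_ℓ, χ_ℓ)` is its `L^p` space. -/
def DomainDecomposition.measure (𝒟 : DomainDecomposition Ω s) (ℓ : Fin s) :
    Measure (EuclideanSpace ℝ (Fin d)) :=
  (volume.restrict (𝒟.sub ℓ)).withDensity fun x => ENNReal.ofReal (𝒟.χ ℓ x)

/-- The forms `φ ↦ (δ u)_j (φ)`. -/
def form (δ : H →ₗ[ℝ] (Fin k → 𝓓'(Ω, ℝ))) (u : H) (j : Fin k) (φ : 𝓓(Ω, ℝ)) : ℝ :=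
  δ u j φ

/-- The forms `φ ↦ (χ_ℓ δ u)_j (φ) = (δ u)_j (χ_ℓ φ)`. -/
def subForm (𝒟 : DomainDecomposition Ω s) (ℓ : Fin s) (δ : H →ₗ[ℝ] (Fin k → 𝓓'(Ω, ℝ)))
    (u : H) (j : Fin k) (φ : 𝓓(Ω, ℝ)) : ℝ :=
  δ u j (mulTest (𝒟.χ ℓ) (𝒟.smooth ℓ) φ)

/-- The energetic space `V`. -/
def V (p : ℝ) (δ : H →ₗ[ℝ] (Fin k → 𝓓'(Ω, ℝ))) : Set H :=
  energySpace (volume.restrict Ω) p (form δ)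

/-- The Friedrich extension `f` of the full vector field, as a graph. The spaces `V_ℓ` are the
energetic spaces that enter `subField`. -/
def field (p : ℝ) (δ : H →ₗ[ℝ] (Fin k → 𝓓'(Ω, ℝ)))
    (α : EuclideanSpace ℝ (Fin d) → EuclideanSpace ℝ (Fin k) → EuclideanSpace ℝ (Fin k)) :
    Set (H × H) :=
  friedrich (volume.restrict Ω) p (form δ) α

/-- The Friedrich extension `f_ℓ` of the decomposed vector field, as a graph. -/
def subField (p : ℝ) (𝒟 : DomainDecomposition Ω s) (δ : H →ₗ[ℝ] (Fin k → 𝓓'(Ω, ℝ)))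
    (α : EuclideanSpace ℝ (Fin d) → EuclideanSpace ℝ (Fin k) → EuclideanSpace ℝ (Fin k))
    (ℓ : Fin s) : Set (H × H) :=
  friedrich (𝒟.measure ℓ) p (subForm 𝒟 ℓ δ) α

/-- Sequential continuity of `δ : H → 𝓓'(Ω)^k`. -/
def SeqContinuousDistr (δ : H →ₗ[ℝ] (Fin k → 𝓓'(Ω, ℝ))) : Prop :=
  ∀ (u : ℕ → H) (a : H), Tendsto u atTop (𝓝 a) →
    ∀ (j : Fin k) (φ : 𝓓(Ω, ℝ)), Tendsto (fun n => δ (u n) j φ) atTop (𝓝 (δ a j φ))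

/-- Carathéodory condition, growth, monotonicity and coercivity of `α` on `Ω`. -/
structure IsMonotoneField (Ω : Opens (EuclideanSpace ℝ (Fin d))) (p : ℝ)
    (α : EuclideanSpace ℝ (Fin d) → EuclideanSpace ℝ (Fin k) → EuclideanSpace ℝ (Fin k)) :
    Prop where
  continuous : ∀ᵐ x ∂volume.restrict (Ω : Set (EuclideanSpace ℝ (Fin d))), Continuous (α x)
  measurable : ∀ z, AEMeasurable (fun x => α x z)
    (volume.restrict (Ω : Set (EuclideanSpace ℝ (Fin d))))
  growth : ∃ (c₁ : ℝ) (c₂ : EuclideanSpace ℝ (Fin d) → ℝ), 0 < c₁ ∧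
    MemLp c₂ (ENNReal.ofReal (p / (p - 1))) (volume.restrict Ω) ∧
    (∀ᵐ x ∂volume.restrict (Ω : Set (EuclideanSpace ℝ (Fin d))), 0 ≤ c₂ x) ∧
    ∀ᵐ x ∂volume.restrict (Ω : Set (EuclideanSpace ℝ (Fin d))),
      ∀ z, ‖α x z‖ ≤ c₁ * ‖z‖ ^ (p - 1) + c₂ x
  monotone : ∀ z z', ∀ᵐ x ∂volume.restrict (Ω : Set (EuclideanSpace ℝ (Fin d))),
    0 ≤ ⟪α x z - α x z', z - z'⟫_ℝ
  coercive : ∃ (c₃ : ℝ) (c₄ : EuclideanSpace ℝ (Fin d) → ℝ), 0 < c₃ ∧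
    Integrable c₄ (volume.restrict Ω) ∧
    ∀ z, ∀ᵐ x ∂volume.restrict (Ω : Set (EuclideanSpace ℝ (Fin d))),
      c₃ * ‖z‖ ^ p - c₄ x ≤ ⟪α x z, z⟫_ℝ

end Concrete

/-! ### Operators in `H`, given by their graphs -/

section Operators

variable {H : Type*} [NormedAddCommGroup H] [InnerProductSpace ℝ H]

/-- The domain of an operator with graph `A`. -/
def dom (A : Set (H × H)) : Set H := {u | ∃ z, (u, z) ∈ A}

/-- The restriction of an operator to `D`. -/
def restrictTo (A : Set (H × H)) (D : Set H) : Set (H × H) := {q | q ∈ A ∧ q.1 ∈ D}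

/-- `u ∈ D(A)` and `u - h A u = v`. -/
def Solves (A : Set (H × H)) (h : ℝ) (v u : H) : Prop := ∃ z, (u, z) ∈ A ∧ u - h • z = v

/-- The resolvent `(I - h A)⁻¹`. -/
def resolventMap (A : Set (H × H)) (h : ℝ) (v : H) : H := Classical.epsilon (Solves A h v)

/-- `e^{tA} η = lim_n (I - (t/n) A)^{-n} η`. -/
def expMap (A : Set (H × H)) (t : ℝ) (η : H) : H :=
  limUnder atTop fun n : ℕ => (resolventMap A (t / n))^[n] η

/-- One step of the Lie splitting: `v₀ = u`, `v_ℓ = (I - h A_ℓ)⁻¹ v_{ℓ-1}` for `ℓ = 1, …, s`, with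
value `v_s`. -/
def lieStep {s : ℕ} (A : Fin s → Set (H × H)) (h : ℝ) (u : H) : H :=
  Fin.foldl s (fun v ℓ => resolventMap (A ℓ) h v) u

end Operators

end DomainSplitting

end

open DomainSplitting

/-!
The operators are treated as dissipative graphs in `H`, and the theorem splits into a statement
about energetic spaces and one about nonlinear semigroups.

*Resolvents.* For a measure `μ` that is dominated by Lebesgue measure on `Ω`, which covers both `Ω`
and the weighted subdomains, the graph of `u ↦ T u` is a closed subspace of `H × L^p(μ)^k`, and
`u - h f u = v` is a monotone, hemicontinuous and coercive equation on it. It is solved by a version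
of the Browder–Minty theorem (`exists_eq_zero_of_monotone`). Weak compactness enters only through
the functional `‖u‖² + ‖U‖_p^p`: it is uniformly convex, hence closed convex sets with the finite
intersection property in one of its sublevel sets have a common point
(`exists_mem_of_finite_inter`). Finite intersections are handled by a matrix game instead of a fixed
point theorem (`exists_stdSimplex_sum_nonneg`). Together with dissipativity, which rests on the
uniqueness of densities (`RepresentedBy.ae_eq`), this shows that all of the operators are
m-dissipative (`isMDissipative_friedrich`).

*Exponential formula.* The distance `a m n` of `m` backward Euler steps of size `h` and `n` steps of
size `l` satisfies `(h + l) a (m+1) (n+1) ≤ h a (m+1) n + l a m (n+1)`, which has the supersolution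
`K √((m h - n l)² + m h² + n l²)` (`le_mul_sqrt_of_recursion`). This gives the convergence of
`(I - (t/n) f)^{-n} η`. The same recursion compares the iterates of a nonexpansive map `P` with the
backward Euler steps of its difference quotient `h⁻¹ (P - I)`; a fixed step size `l` for the latter
yields the product formula, uniformly in time, as soon as the resolvents of the difference quotients
converge (`IsMDissipative.tendstoUniformlyOn_iterate`).

*Consistency of the splitting.* If `u = (I - l f)⁻¹ x` is in all of the domains `D(f_ℓ)`, then
`f u = ∑ f_ℓ u` (`eq_sum_of_mem_subField`). Testing the dissipativity of `f_ℓ` at the intermediate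
values of the Lie step against `u` and summing up produces nonnegative quadratic terms that absorb
the error made by evaluating the `f_ℓ` at different points. The resolvents of the difference
quotients thus differ from `u` by at most a multiple of `√h`
(`norm_resolventMap_lieStep_sub_sq_le`). Such `x` are dense by the range condition and the density
of `V`, and resolvents are nonexpansive, so that the product formula applies.
-/

noncomputable section

namespace DomainSplitting

/-! ### Dissipative graphs and their resolvents -/

theorem norm_iterate_sub_le {H : Type*} [NormedAddCommGroup H] {P : H → H}
    (hP : ∀ x y, ‖P x - P y‖ ≤ ‖x - y‖) (n : ℕ) (x y : H) :
    ‖P^[n] x - P^[n] y‖ ≤ ‖x - y‖ := by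
  induction n with
  | zero => rfl
  | succ n ih =>
    rw [Function.iterate_succ_apply', Function.iterate_succ_apply']
    exact (hP _ _).trans ih

theorem norm_iterate_sub_self_le {H : Type*} [NormedAddCommGroup H] {P : H → H}
    (hP : ∀ x y, ‖P x - P y‖ ≤ ‖x - y‖) (n : ℕ) (x : H) :
    ‖P^[n] x - x‖ ≤ n * ‖P x - x‖ := by
  induction n with
  | zero => simp
  | succ n ih =>
    rw [Function.iterate_succ_apply]
    have h1 := norm_iterate_sub_le hP n (P x) x
    have h2 := norm_sub_le_norm_sub_add_norm_sub (P^[n] (P x)) (P^[n] x) x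
    push_cast
    linarith

section Dissipative

variable {H : Type*} [NormedAddCommGroup H] [InnerProductSpace ℝ H] {A : Set (H × H)}

/-- The graph `A` is dissipative, that is, `-A` is monotone. -/
def IsDissipative (A : Set (H × H)) : Prop :=
  ∀ q ∈ A, ∀ r ∈ A, ⟪q.2 - r.2, q.1 - r.1⟫_ℝ ≤ 0

/-- The graph `A` is m-dissipative: it is dissipative and `I - h A` is onto for every `h > 0`. -/
def IsMDissipative (A : Set (H × H)) : Prop :=
  IsDissipative A ∧ ∀ h : ℝ, 0 < h → ∀ v, ∃ u, Solves A h v u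

theorem IsDissipative.norm_sub_le (hA : IsDissipative A) {h : ℝ} (hh : 0 ≤ h) {v v' u u' : H}
    (hu : Solves A h v u) (hu' : Solves A h v' u') : ‖u - u'‖ ≤ ‖v - v'‖ := by
  obtain ⟨z, hz, rfl⟩ := hu
  obtain ⟨z', hz', rfl⟩ := hu'
  have h1 : ⟪z - z', u - u'⟫_ℝ ≤ 0 := hA _ hz _ hz'
  have h2 : ⟪(u - h • z) - (u' - h • z'), u - u'⟫_ℝ = ‖u - u'‖ ^ 2 - h * ⟪z - z', u - u'⟫_ℝ := by
    rw [show (u - h • z) - (u' - h • z') = (u - u') - h • (z - z') by module, inner_sub_left,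
      real_inner_smul_left, real_inner_self_eq_norm_sq]
  have h3 := real_inner_le_norm ((u - h • z) - (u' - h • z')) (u - u')
  rcases (norm_nonneg (u - u')).eq_or_lt with h0 | h0
  · rw [← h0]; exact norm_nonneg _
  · refine le_of_mul_le_mul_right ?_ h0
    nlinarith [mul_nonneg hh (neg_nonneg.2 h1)]

theorem IsMDissipative.existsUnique (hA : IsMDissipative A) {h : ℝ} (hh : 0 < h) (v : H) :
    ∃! u, Solves A h v u := by
  obtain ⟨u, hu⟩ := hA.2 h hh v
  refine ⟨u, hu, fun u' hu' => ?_⟩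
  have := hA.1.norm_sub_le hh.le hu' hu
  rw [sub_self, norm_zero] at this
  exact sub_eq_zero.1 (norm_le_zero_iff.1 this)

theorem IsMDissipative.solves (hA : IsMDissipative A) {h : ℝ} (hh : 0 < h) (v : H) :
    Solves A h v (resolventMap A h v) :=
  Classical.epsilon_spec (hA.2 h hh v)

theorem IsMDissipative.resolventMap_eq (hA : IsMDissipative A) {h : ℝ} (hh : 0 < h) {v u : H}
    (hu : Solves A h v u) : resolventMap A h v = u :=
  (hA.existsUnique hh v).unique (hA.solves hh v) hu

theorem IsMDissipative.norm_resolventMap_sub_le (hA : IsMDissipative A) {h : ℝ} (hh : 0 < h)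
    (v v' : H) : ‖resolventMap A h v - resolventMap A h v'‖ ≤ ‖v - v'‖ :=
  hA.1.norm_sub_le hh.le (hA.solves hh v) (hA.solves hh v')

theorem IsMDissipative.norm_resolventMap_sub_self_le (hA : IsMDissipative A) {h : ℝ} (hh : 0 < h)
    {x z : H} (hx : (x, z) ∈ A) : ‖resolventMap A h x - x‖ ≤ h * ‖z‖ := by
  have := hA.1.norm_sub_le hh.le (hA.solves hh x) ⟨z, hx, rfl⟩
  rwa [sub_sub_cancel, norm_smul, Real.norm_of_nonneg hh.le] at this

/-- Two backward Euler steps, of sizes `h` and `l`: the recursion that is solved by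
`le_mul_sqrt_of_recursion`. -/
theorem IsMDissipative.resolventMap_recursion (hA : IsMDissipative A) {h l : ℝ} (hh : 0 < h)
    (hl : 0 < l) (x y : H) :
    (h + l) * ‖resolventMap A h x - resolventMap A l y‖ ≤
      h * ‖resolventMap A h x - y‖ + l * ‖x - resolventMap A l y‖ := by
  obtain ⟨z, hz, hx⟩ := hA.solves hh x
  obtain ⟨w, hw, hy⟩ := hA.solves hl y
  set x' := resolventMap A h x
  set y' := resolventMap A l y
  have h1 : ⟪z - w, x' - y'⟫_ℝ ≤ 0 := hA.1 _ hz _ hw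
  have h2 : h • (x' - y) + l • (x - y') = (h + l) • (x' - y') - (h * l) • (z - w) := by
    rw [← hx, ← hy]; module
  have h3 : ⟪h • (x' - y) + l • (x - y'), x' - y'⟫_ℝ
      = (h + l) * ‖x' - y'‖ ^ 2 - h * l * ⟪z - w, x' - y'⟫_ℝ := by
    rw [h2, inner_sub_left, real_inner_smul_left, real_inner_smul_left, real_inner_self_eq_norm_sq]
  have h4 := real_inner_le_norm (h • (x' - y) + l • (x - y')) (x' - y')
  have h5 : ‖h • (x' - y) + l • (x - y')‖ ≤ h * ‖x' - y‖ + l * ‖x - y'‖ := by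
    refine (norm_add_le _ _).trans_eq ?_
    rw [norm_smul, norm_smul, Real.norm_of_nonneg hh.le, Real.norm_of_nonneg hl.le]
  refine le_trans ?_ h5
  rcases (norm_nonneg (x' - y')).eq_or_lt with h0 | h0
  · rw [← h0, mul_zero]; exact norm_nonneg _
  · refine le_of_mul_le_mul_right ?_ h0
    nlinarith [mul_nonneg (mul_pos hh hl).le (neg_nonneg.2 h1)]

/-- The recursion satisfied by the distance of two time discretizations, of step sizes `h` and `l`,
has the explicit supersolution `K √((m h - n l)² + m h² + n l²)`. -/
theorem le_mul_sqrt_of_recursion {h l K : ℝ} (hh : 0 < h) (hl : 0 < l) (hK : 0 ≤ K)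
    {a : ℕ → ℕ → ℝ} (h0 : ∀ m : ℕ, a m 0 ≤ m * h * K) (h0' : ∀ n : ℕ, a 0 n ≤ n * l * K)
    (hrec : ∀ m n, (h + l) * a (m + 1) (n + 1) ≤ h * a (m + 1) n + l * a m (n + 1)) (m n : ℕ) :
    a m n ≤ K * √((m * h - n * l) ^ 2 + m * h ^ 2 + n * l ^ 2) := by
  induction m generalizing n with
  | zero =>
    refine (h0' n).trans ?_
    rw [mul_comm]
    refine mul_le_mul_of_nonneg_left (Real.le_sqrt_of_sq_le ?_) hK
    have : 0 ≤ (n : ℝ) * l ^ 2 := by positivity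
    push_cast
    nlinarith
  | succ m ihm =>
    induction n with
    | zero =>
      refine (h0 _).trans ?_
      rw [mul_comm]
      refine mul_le_mul_of_nonneg_left (Real.le_sqrt_of_sq_le ?_) hK
      have : 0 ≤ ((m + 1 : ℕ) : ℝ) * h ^ 2 := by positivity
      push_cast at this ⊢
      nlinarith
    | succ n ihn =>
      have h1 := ihm (n + 1)
      have h2 := hrec m n
      set D₁ := (((m + 1 : ℕ) : ℝ) * h - n * l) ^ 2 + ((m + 1 : ℕ) : ℝ) * h ^ 2 + n * l ^ 2 with hD₁
      set D₂ := ((m : ℝ) * h - ((n + 1 : ℕ) : ℝ) * l) ^ 2 + m * h ^ 2 + ((n + 1 : ℕ) : ℝ) * l ^ 2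
        with hD₂
      set D := (((m + 1 : ℕ) : ℝ) * h - ((n + 1 : ℕ) : ℝ) * l) ^ 2 + ((m + 1 : ℕ) : ℝ) * h ^ 2
        + ((n + 1 : ℕ) : ℝ) * l ^ 2 with hD
      have hD₁0 : 0 ≤ D₁ := by positivity
      have hD₂0 : 0 ≤ D₂ := by positivity
      have hD0 : 0 ≤ D := by positivity
      -- the defect of `r ↦ r²` at `r = m h - n l` is `h l`, which the variance terms compensate
      have hDeq : h * D₁ + l * D₂ = (h + l) * D := by
        rw [hD₁, hD₂, hD]; push_cast; ring
      have h3 : h * √D₁ + l * √D₂ ≤ (h + l) * √D := by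
        refine abs_le_of_sq_le_sq' ?_ (by positivity) |>.2
        have e1 := Real.sq_sqrt hD₁0
        have e2 := Real.sq_sqrt hD₂0
        have e3 := Real.sq_sqrt hD0
        have : (h + l) ^ 2 * D = (h + l) * (h * D₁ + l * D₂) := by rw [hDeq]; ring
        rw [mul_pow, e3, this, ← e1, ← e2, Real.sqrt_sq (Real.sqrt_nonneg _),
          Real.sqrt_sq (Real.sqrt_nonneg _)]
        nlinarith [mul_nonneg (mul_pos hh hl).le (sq_nonneg (√D₁ - √D₂))]
      refine le_of_mul_le_mul_left ?_ (add_pos hh hl)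
      calc (h + l) * a (m + 1) (n + 1) ≤ h * a (m + 1) n + l * a m (n + 1) := h2
        _ ≤ h * (K * √D₁) + l * (K * √D₂) := by gcongr
        _ = K * (h * √D₁ + l * √D₂) := by ring
        _ ≤ K * ((h + l) * √D) := by gcongr
        _ = _ := by ring

/-- The Crandall–Liggett estimate: distance of two backward Euler approximations of different step
sizes that start at the same point of the domain. -/
theorem IsMDissipative.norm_iterate_sub_iterate_le (hA : IsMDissipative A) {h l : ℝ} (hh : 0 < h)
    (hl : 0 < l) {x z : H} (hx : (x, z) ∈ A) (m n : ℕ) :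
    ‖(resolventMap A h)^[m] x - (resolventMap A l)^[n] x‖ ≤
      ‖z‖ * √((m * h - n * l) ^ 2 + m * h ^ 2 + n * l ^ 2) := by
  refine le_mul_sqrt_of_recursion hh hl (norm_nonneg z)
    (a := fun m n => ‖(resolventMap A h)^[m] x - (resolventMap A l)^[n] x‖) ?_ ?_ ?_ m n
  · intro m
    refine (norm_iterate_sub_self_le (hA.norm_resolventMap_sub_le hh) m x).trans ?_
    rw [mul_assoc]
    gcongr
    exact hA.norm_resolventMap_sub_self_le hh hx
  · intro n
    rw [norm_sub_rev]
    refine (norm_iterate_sub_self_le (hA.norm_resolventMap_sub_le hl) n x).trans ?_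
    rw [mul_assoc]
    gcongr
    exact hA.norm_resolventMap_sub_self_le hl hx
  · intro m n
    simp only [Function.iterate_succ_apply']
    exact hA.resolventMap_recursion hh hl _ _

end Dissipative

/-! ### The exponential formula -/

section Exponential

variable {H : Type*} [NormedAddCommGroup H] [InnerProductSpace ℝ H] {A : Set (H × H)}

theorem IsMDissipative.cauchySeq_iterate (hA : IsMDissipative A) (hdom : Dense (dom A)) {t : ℝ}
    (ht : 0 < t) (η : H) : CauchySeq fun n : ℕ => (resolventMap A (t / n))^[n] η := by
  rw [Metric.cauchySeq_iff']
  intro ε hε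
  obtain ⟨x, hx, z, hz⟩ := Metric.dense_iff.1 hdom η (ε / 4) (by positivity)
  rw [Metric.mem_ball, dist_eq_norm] at hx
  have hlim : Tendsto (fun N : ℕ => ‖z‖ * √(2 * t ^ 2 / (N + 1 : ℕ))) atTop (𝓝 0) := by
    have h1 : Tendsto (fun N : ℕ => 2 * t ^ 2 / ((N + 1 : ℕ) : ℝ)) atTop (𝓝 0) :=
      (tendsto_const_div_atTop_nhds_zero_nat (2 * t ^ 2)).comp (tendsto_add_atTop_nat 1)
    simpa using (h1.sqrt).const_mul ‖z‖
  obtain ⟨N, hN⟩ := (hlim.eventually (gt_mem_nhds (show (0 : ℝ) < ε / 4 by positivity))).exists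
  refine ⟨N + 1, fun n hn => ?_⟩
  have hn0 : (0 : ℝ) < n := by exact_mod_cast (Nat.succ_pos N).trans_le hn
  have hN0 : (0 : ℝ) < (N + 1 : ℕ) := by positivity
  have hNn : ((N + 1 : ℕ) : ℝ) ≤ n := by exact_mod_cast hn
  have e1 := hA.norm_iterate_sub_iterate_le (div_pos ht hn0) (div_pos ht hN0) hz n (N + 1)
  have e2 : √((n * (t / n) - (N + 1 : ℕ) * (t / (N + 1 : ℕ))) ^ 2 + n * (t / n) ^ 2 +
      (N + 1 : ℕ) * (t / (N + 1 : ℕ)) ^ 2) ≤ √(2 * t ^ 2 / (N + 1 : ℕ)) := by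
    refine Real.sqrt_le_sqrt ?_
    rw [mul_div_cancel₀ _ hn0.ne', mul_div_cancel₀ _ hN0.ne']
    have : n * (t / n) ^ 2 = t ^ 2 / n := by field_simp
    have h' : (N + 1 : ℕ) * (t / (N + 1 : ℕ)) ^ 2 = t ^ 2 / (N + 1 : ℕ) := by field_simp
    rw [this, h']
    have : t ^ 2 / n ≤ t ^ 2 / (N + 1 : ℕ) := by gcongr
    have h3 : 2 * t ^ 2 / (N + 1 : ℕ) = t ^ 2 / (N + 1 : ℕ) + t ^ 2 / (N + 1 : ℕ) := by ring
    rw [h3]; linarith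
  have e3 := mul_le_mul_of_nonneg_left e2 (norm_nonneg z)
  have e4 := norm_iterate_sub_le (hA.norm_resolventMap_sub_le (div_pos ht hn0)) n x η
  have e5 := norm_iterate_sub_le (hA.norm_resolventMap_sub_le (div_pos ht hN0)) (N + 1) x η
  rw [dist_eq_norm]
  set p := (resolventMap A (t / n))^[n] η
  set p' := (resolventMap A (t / n))^[n] x
  set q := (resolventMap A (t / (N + 1 : ℕ)))^[N + 1] η
  set q' := (resolventMap A (t / (N + 1 : ℕ)))^[N + 1] x
  have : p - q = -(p' - p) + (p' - q') + (q' - q) := by abel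
  have e6 : ‖p - q‖ ≤ ‖p' - p‖ + ‖p' - q'‖ + ‖q' - q‖ := by
    rw [this]
    refine (norm_add₃_le).trans_eq ?_
    rw [norm_neg]
  linarith

variable [CompleteSpace H]

theorem IsMDissipative.tendsto_expMap (hA : IsMDissipative A) (hdom : Dense (dom A)) {t : ℝ}
    (ht : 0 < t) (η : H) :
    Tendsto (fun n : ℕ => (resolventMap A (t / n))^[n] η) atTop (𝓝 (expMap A t η)) :=
  (hA.cauchySeq_iterate hdom ht η).tendsto_limUnder

theorem IsMDissipative.norm_expMap_sub_le (hA : IsMDissipative A) (hdom : Dense (dom A)) {t : ℝ}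
    (ht : 0 < t) (η η' : H) : ‖expMap A t η - expMap A t η'‖ ≤ ‖η - η'‖ := by
  refine le_of_tendsto ((hA.tendsto_expMap hdom ht η).sub (hA.tendsto_expMap hdom ht η')).norm ?_
  filter_upwards [eventually_gt_atTop 0] with n hn
  exact norm_iterate_sub_le (hA.norm_resolventMap_sub_le (div_pos ht (by exact_mod_cast hn))) n _ _

/-- The error of `j` backward Euler steps of size `l` at a time `t` that need not equal `j l`. -/
theorem IsMDissipative.norm_expMap_sub_iterate_le (hA : IsMDissipative A) (hdom : Dense (dom A))
    {t l : ℝ} (ht : 0 < t) (hl : 0 < l) {x z : H} (hx : (x, z) ∈ A) (j : ℕ) :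
    ‖expMap A t x - (resolventMap A l)^[j] x‖ ≤ ‖z‖ * √((t - j * l) ^ 2 + j * l ^ 2) := by
  have h1 : Tendsto (fun n : ℕ => ‖z‖ * √((t - j * l) ^ 2 + t ^ 2 / n + j * l ^ 2)) atTop
      (𝓝 (‖z‖ * √((t - j * l) ^ 2 + 0 + j * l ^ 2))) :=
    (((tendsto_const_div_atTop_nhds_zero_nat (t ^ 2)).const_add _).add_const _).sqrt.const_mul _
  rw [add_zero] at h1
  refine le_of_tendsto_of_tendsto ((hA.tendsto_expMap hdom ht x).sub_const _).norm h1 ?_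
  filter_upwards [eventually_gt_atTop 0] with n hn
  have hn0 : (0 : ℝ) < n := by exact_mod_cast hn
  have := hA.norm_iterate_sub_iterate_le (div_pos ht hn0) hl hx n j
  rwa [mul_div_cancel₀ _ hn0.ne', show n * (t / n) ^ 2 = t ^ 2 / n by field_simp] at this

end Exponential

/-! ### Difference quotients of nonexpansive maps and the product formula -/

section Chernoff

/-- Convergence of resolvents passes to their iterates. -/
theorem tendsto_iterate_of_tendsto {ι H : Type*} [NormedAddCommGroup H] {F : Filter ι}
    {R : ι → H → H} {J : H → H}
    (hR : ∀ᶠ i in F, ∀ x y, ‖R i x - R i y‖ ≤ ‖x - y‖)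
    (hlim : ∀ x, Tendsto (fun i => R i x) F (𝓝 (J x))) (j : ℕ) (x : H) :
    Tendsto (fun i => (R i)^[j] x) F (𝓝 (J^[j] x)) := by
  induction j with
  | zero => exact tendsto_const_nhds
  | succ j ih =>
    simp only [Function.iterate_succ_apply']
    have h1 : Tendsto (fun i => R i ((R i)^[j] x) - R i (J^[j] x)) F (𝓝 0) := by
      refine squeeze_zero_norm' (hR.mono fun i hi => hi _ _) ?_
      simpa using (ih.sub_const (J^[j] x)).norm
    simpa using h1.add (hlim (J^[j] x))

variable {H : Type*} [NormedAddCommGroup H] [InnerProductSpace ℝ H]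

/-- The graph of the everywhere defined operator `h⁻¹ (P - I)`. -/
def quotientGraph (P : H → H) (h : ℝ) : Set (H × H) := {q | q.2 = h⁻¹ • (P q.1 - q.1)}

/-- The quotients of a nonexpansive map are m-dissipative; the resolvent equation is the fixed point
problem of a contraction. -/
theorem isMDissipative_quotientGraph [CompleteSpace H] {P : H → H}
    (hP : ∀ x y, ‖P x - P y‖ ≤ ‖x - y‖) {h : ℝ} (hh : 0 < h) :
    IsMDissipative (quotientGraph P h) := by
  refine ⟨?_, fun l hl v => ?_⟩
  · rintro ⟨x, z⟩ hz ⟨y, w⟩ hw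
    change z = h⁻¹ • (P x - x) at hz
    change w = h⁻¹ • (P y - y) at hw
    have h1 := real_inner_le_norm (P x - P y) (x - y)
    have h2 := mul_le_mul_of_nonneg_right (hP x y) (norm_nonneg (x - y))
    change ⟪z - w, x - y⟫_ℝ ≤ 0
    rw [hz, hw, show h⁻¹ • (P x - x) - h⁻¹ • (P y - y) = h⁻¹ • ((P x - P y) - (x - y)) by module,
      real_inner_smul_left, inner_sub_left, real_inner_self_eq_norm_sq]
    refine mul_nonpos_of_nonneg_of_nonpos (inv_pos.2 hh).le ?_
    nlinarith
  · have hhl : 0 < h + l := add_pos hh hl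
    let Φ : H → H := fun u => (h / (h + l)) • v + (l / (h + l)) • P u
    have hΦ : ContractingWith (l / (h + l)).toNNReal Φ := by
      refine ⟨?_, ?_⟩
      · rw [Real.toNNReal_lt_one, div_lt_one hhl]; linarith
      · refine LipschitzWith.of_dist_le_mul fun x y => ?_
        rw [Real.coe_toNNReal _ (by positivity), dist_eq_norm, dist_eq_norm,
          show Φ x - Φ y = (l / (h + l)) • (P x - P y) by simp only [Φ]; module,
          norm_smul, Real.norm_of_nonneg (by positivity)]
        gcongr
        exact hP x y
    have hfix := hΦ.fixedPoint_isFixedPt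
    set u := hΦ.fixedPoint Φ
    have hu : (h + l) • u = h • v + l • P u := by
      conv_lhs => rw [← hfix.eq]
      simp only [Φ]
      rw [smul_add, smul_smul, smul_smul, mul_div_cancel₀ _ hhl.ne', mul_div_cancel₀ _ hhl.ne']
    refine ⟨u, h⁻¹ • (P u - u), rfl, ?_⟩
    have h1 : h • (u - l • h⁻¹ • (P u - u)) = h • v := by
      have : h • (u - l • h⁻¹ • (P u - u)) = (h + l) • u - l • P u := by
        rw [smul_sub, smul_comm l h⁻¹, smul_inv_smul₀ hh.ne']; module
      rw [this, hu, add_sub_cancel_right]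
    exact smul_right_injective H hh.ne' h1

/-- Distance of the iterates of a nonexpansive map to the backward Euler approximations of its
difference quotient. -/
theorem norm_iterate_sub_resolventMap_quotientGraph_le [CompleteSpace H] {P : H → H}
    (hP : ∀ x y, ‖P x - P y‖ ≤ ‖x - y‖) {h l : ℝ} (hh : 0 < h) (hl : 0 < l) (x : H) (m n : ℕ) :
    ‖P^[m] x - (resolventMap (quotientGraph P h) l)^[n] x‖ ≤
      ‖h⁻¹ • (P x - x)‖ * √((m * h - n * l) ^ 2 + m * h ^ 2 + n * l ^ 2) := by
  have hQ := isMDissipative_quotientGraph hP hh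
  refine le_mul_sqrt_of_recursion hh hl (norm_nonneg _)
    (a := fun m n => ‖P^[m] x - (resolventMap (quotientGraph P h) l)^[n] x‖) ?_ ?_ ?_ m n
  · intro m
    refine (norm_iterate_sub_self_le hP m x).trans_eq ?_
    rw [norm_smul, norm_inv, Real.norm_of_nonneg hh.le]
    field_simp
  · intro n
    rw [norm_sub_rev]
    refine (norm_iterate_sub_self_le (hQ.norm_resolventMap_sub_le hl) n x).trans ?_
    rw [mul_assoc]
    gcongr
    exact hQ.norm_resolventMap_sub_self_le hl rfl
  · intro m n
    simp only [Function.iterate_succ_apply']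
    set X := P^[m] x
    set Y := (resolventMap (quotientGraph P h) l)^[n] x
    obtain ⟨z, hz, hY⟩ := hQ.solves hl Y
    set Y' := resolventMap (quotientGraph P h) l Y
    change z = h⁻¹ • (P Y' - Y') at hz
    have h1 : (h + l) • (P X - Y') = h • (P X - Y) + l • (P X - P Y') := by
      rw [← hY, hz, smul_sub h, smul_sub h, smul_comm h l, smul_inv_smul₀ hh.ne']; module
    calc (h + l) * ‖P X - Y'‖ = ‖(h + l) • (P X - Y')‖ := by
          rw [norm_smul, Real.norm_of_nonneg (add_pos hh hl).le]
      _ ≤ h * ‖P X - Y‖ + l * ‖P X - P Y'‖ := by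
          rw [h1]
          refine (norm_add_le _ _).trans_eq ?_
          rw [norm_smul, norm_smul, Real.norm_of_nonneg hh.le, Real.norm_of_nonneg hl.le]
      _ ≤ h * ‖P X - Y‖ + l * ‖X - Y'‖ := by gcongr; exact hP _ _

/-- The nonlinear Chernoff product formula. The step `l` of the backward Euler approximations that
`P h` is compared with is kept fixed while `h → 0`. -/
theorem IsMDissipative.tendstoUniformlyOn_iterate [CompleteSpace H] {A : Set (H × H)}
    (hA : IsMDissipative A) (hdom : Dense (dom A)) {P : ℝ → H → H}
    (hP : ∀ h, 0 < h → ∀ x y, ‖P h x - P h y‖ ≤ ‖x - y‖)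
    (hcons : ∀ l, 0 < l → ∀ x, Tendsto (fun h => resolventMap (quotientGraph (P h) h) l x)
      (𝓝[>] 0) (𝓝 (resolventMap A l x))) (η : H) (T : ℝ) :
    TendstoUniformlyOn (fun (n : ℕ) (t : ℝ) => (P (t / n))^[n] η) (fun t => expMap A t η) atTop
      (Ioo 0 T) := by
  rw [Metric.tendstoUniformlyOn_iff]
  intro ε hε
  rcases le_or_gt T 0 with hT | hT
  · simp [Ioo_eq_empty_of_le hT]
  obtain ⟨x, hxη, z, hz⟩ := Metric.dense_iff.1 hdom η (ε / 8) (by positivity)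
  rw [Metric.mem_ball, dist_eq_norm] at hxη
  obtain ⟨l, hl, hlε⟩ : ∃ l : ℝ, 0 < l ∧ (‖z‖ + 1) * √(l ^ 2 + 2 * T * l) < ε / 8 := by
    have h1 : Tendsto (fun l : ℝ => (‖z‖ + 1) * √(l ^ 2 + 2 * T * l)) (𝓝[>] 0) (𝓝 0) := by
      have : Continuous fun l : ℝ => (‖z‖ + 1) * √(l ^ 2 + 2 * T * l) := by fun_prop
      simpa using this.continuousWithinAt (s := Ioi (0 : ℝ)) (x := 0) |>.tendsto
    obtain ⟨l, h2, h3⟩ := ((h1.eventually (gt_mem_nhds (show (0 : ℝ) < ε / 8 by positivity))).and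
      self_mem_nhdsWithin).exists
    exact ⟨l, h3, h2⟩
  let R : ℝ → ℝ → H → H := fun h => resolventMap (quotientGraph (P h) h)
  -- a starting value near `x` at which the difference quotients stay bounded
  let y : ℝ → H := fun h => R h 1 (x - z)
  have hQ : ∀ h, 0 < h → IsMDissipative (quotientGraph (P h) h) := fun h hh =>
    isMDissipative_quotientGraph (hP h hh) hh
  -- the limit is the resolvent of `A` at `x - z`, which is `x`
  have hy : Tendsto y (𝓝[>] 0) (𝓝 x) := by
    have := hcons 1 one_pos (x - z)
    rwa [hA.resolventMap_eq one_pos (u := x) ⟨z, hz, by rw [one_smul]⟩] at this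
  have hyq : ∀ h, 0 < h → h⁻¹ • (P h (y h) - y h) = y h - (x - z) := by
    intro h hh
    obtain ⟨w, hw, hw'⟩ := (hQ h hh).solves one_pos (x - z)
    change w = h⁻¹ • (P h (y h) - y h) at hw
    change y h - (1 : ℝ) • w = _ at hw'
    rw [← hw, ← hw', one_smul, sub_sub_cancel]
  have hy' : ∀ᶠ h in 𝓝[>] (0 : ℝ), ‖h⁻¹ • (P h (y h) - y h)‖ < ‖z‖ + 1 := by
    have h1 : Tendsto (fun h => ‖y h - (x - z)‖) (𝓝[>] 0) (𝓝 ‖z‖) := by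
      have := (hy.sub_const (x - z)).norm
      rwa [sub_sub_cancel] at this
    filter_upwards [h1.eventually (gt_mem_nhds (lt_add_one ‖z‖)), self_mem_nhdsWithin] with h h2 hh
    rwa [hyq h hh]
  have hy'' : ∀ᶠ h in 𝓝[>] (0 : ℝ), ‖y h - x‖ < ε / 8 :=
    (tendsto_iff_norm_sub_tendsto_zero.1 hy).eventually (gt_mem_nhds (by positivity))
  have hj : ∀ᶠ h in 𝓝[>] (0 : ℝ), ∀ j ∈ Finset.range (⌊T / l⌋₊ + 1),
      ‖(R h l)^[j] x - (resolventMap A l)^[j] x‖ < ε / 8 := by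
    rw [Finset.eventually_all]
    intro j _
    have h1 : Tendsto (fun h => (R h l)^[j] x) (𝓝[>] 0) (𝓝 ((resolventMap A l)^[j] x)) := by
      refine tendsto_iterate_of_tendsto ?_ (fun v => hcons l hl v) j x
      filter_upwards [self_mem_nhdsWithin] with h hh
      exact (hQ h hh).norm_resolventMap_sub_le hl
    exact (tendsto_iff_norm_sub_tendsto_zero.1 h1).eventually (gt_mem_nhds (by positivity))
  have hhl : ∀ᶠ h in 𝓝[>] (0 : ℝ), h < l := nhdsWithin_le_nhds (gt_mem_nhds hl)
  obtain ⟨h₀, hh₀, hall⟩ :=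
    mem_nhdsGT_iff_exists_Ioo_subset.1 (hy'.and (hy''.and (hj.and hhl)))
  filter_upwards [eventually_gt_atTop 0,
    (tendsto_const_div_atTop_nhds_zero_nat T).eventually (gt_mem_nhds hh₀)] with n hn hnT t ht
  have hn0 : (0 : ℝ) < n := by exact_mod_cast hn
  have hh : 0 < t / n := div_pos ht.1 hn0
  have hth₀ : t / n < h₀ := lt_of_le_of_lt (by gcongr; exact ht.2.le) hnT
  obtain ⟨a1, a2, a3, a4⟩ := hall ⟨hh, hth₀⟩
  have hnh : n * (t / n) = t := mul_div_cancel₀ _ hn0.ne'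
  set h := t / n with hh_def
  -- `j` backward Euler steps of size `l` reach `t` up to an error of at most `l`
  set j := ⌊t / l⌋₊ with hj_def
  have hj1 : j * l ≤ t := by
    have := Nat.floor_le (div_pos ht.1 hl).le
    rwa [le_div_iff₀ hl] at this
  have hj2 : t - j * l ≤ l := by
    have := (Nat.lt_floor_add_one (t / l)).le
    rw [div_le_iff₀ hl] at this
    change t ≤ (j + 1) * l at this
    linarith
  have hj3 : j ∈ Finset.range (⌊T / l⌋₊ + 1) := by
    rw [Finset.mem_range, Nat.lt_succ_iff]
    exact Nat.floor_le_floor (by gcongr; exact ht.2.le)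
  have hsq : (t - j * l) ^ 2 ≤ l ^ 2 := pow_le_pow_left₀ (sub_nonneg.2 hj1) hj2 2
  have hjl : j * l ^ 2 ≤ T * l := by
    have := mul_le_mul_of_nonneg_right (hj1.trans ht.2.le) hl.le
    linarith [this, show (j : ℝ) * l ^ 2 = j * l * l by ring]
  -- the chain `P^n η, P^n x, P^n y, R^j y, R^j x, J^j x, e^{tA} x, e^{tA} η`
  have b1 : ‖(P h)^[n] (y h) - (R h l)^[j] (y h)‖ < ε / 8 := by
    refine (norm_iterate_sub_resolventMap_quotientGraph_le (hP h hh) hh hl (y h) n j).trans_lt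
      (lt_of_le_of_lt (mul_le_mul a1.le (Real.sqrt_le_sqrt ?_) (Real.sqrt_nonneg _)
        (by positivity)) hlε)
    have : n * h ^ 2 ≤ T * l := by
      have e : (n : ℝ) * h ^ 2 = t * h := by rw [← hnh]; ring
      rw [e]
      exact mul_le_mul ht.2.le a4.le hh.le hT.le
    rw [hnh]
    linarith
  have b2 : ‖expMap A t x - (resolventMap A l)^[j] x‖ < ε / 8 := by
    refine (hA.norm_expMap_sub_iterate_le hdom ht.1 hl hz j).trans_lt
      (lt_of_le_of_lt (mul_le_mul (lt_add_one _).le (Real.sqrt_le_sqrt ?_) (Real.sqrt_nonneg _)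
        (by positivity)) hlε)
    linarith [mul_pos hT hl]
  have b3 := a3 j hj3
  have b4 := hA.norm_expMap_sub_le hdom ht.1 x η
  have b5 := norm_iterate_sub_le ((hQ h hh).norm_resolventMap_sub_le hl) j (y h) x
  change ‖(R h l)^[j] (y h) - (R h l)^[j] x‖ ≤ _ at b5
  have b6 := norm_iterate_sub_le (hP h hh) n (y h) x
  have b7 := norm_iterate_sub_le (hP h hh) n x η
  rw [← dist_eq_norm] at *
  have c1 := dist_triangle4 (expMap A t η) (expMap A t x) ((resolventMap A l)^[j] x)
    ((R h l)^[j] x)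
  have c2 := dist_triangle4 ((R h l)^[j] x) ((R h l)^[j] (y h)) ((P h)^[n] (y h)) ((P h)^[n] x)
  have c3 := dist_triangle4 (expMap A t η) ((R h l)^[j] x) ((P h)^[n] x) ((P h)^[n] η)
  simp only [← dist_eq_norm] at *
  rw [dist_comm] at b3 b4 b5 b1
  linarith

end Chernoff

/-! ### Consistency of the Lie splitting -/

section Lie

variable {H : Type*} [NormedAddCommGroup H] [InnerProductSpace ℝ H]

theorem lieStep_succ {s : ℕ} (A : Fin (s + 1) → Set (H × H)) (h : ℝ) (u : H) :
    lieStep A h u =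
      resolventMap (A (Fin.last s)) h (lieStep (fun ℓ => A (Fin.castSucc ℓ)) h u) := by
  simp only [lieStep, Fin.foldl_succ_last]

theorem norm_lieStep_sub_le {s : ℕ} {A : Fin s → Set (H × H)} (hA : ∀ ℓ, IsMDissipative (A ℓ))
    {h : ℝ} (hh : 0 < h) (x y : H) : ‖lieStep A h x - lieStep A h y‖ ≤ ‖x - y‖ := by
  induction s with
  | zero => simp [lieStep]
  | succ s ih =>
    rw [lieStep_succ, lieStep_succ]
    exact ((hA _).norm_resolventMap_sub_le hh _ _).trans (ih fun ℓ => hA _)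

/-- The intermediate values of a Lie step, and the values of the operators at them. -/
theorem exists_lieStep_chain {s : ℕ} {A : Fin s → Set (H × H)} (hA : ∀ ℓ, IsMDissipative (A ℓ))
    {h : ℝ} (hh : 0 < h) (u : H) :
    ∃ (v : Fin (s + 1) → H) (w : Fin s → H), v 0 = u ∧ v (Fin.last s) = lieStep A h u ∧
      ∀ ℓ, (v ℓ.succ, w ℓ) ∈ A ℓ ∧ v ℓ.succ - v ℓ.castSucc = h • w ℓ := by
  induction s with
  | zero => exact ⟨fun _ => u, Fin.elim0, rfl, by simp [lieStep], fun ℓ => ℓ.elim0⟩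
  | succ s ih =>
    obtain ⟨v, w, h0, h1, h2⟩ := ih fun ℓ => hA (Fin.castSucc ℓ)
    obtain ⟨z, hz, hz'⟩ := (hA (Fin.last s)).solves hh (v (Fin.last s))
    refine ⟨Fin.snoc v (resolventMap (A (Fin.last s)) h (v (Fin.last s))), Fin.snoc w z, ?_, ?_, ?_⟩
    · rw [← h0, ← Fin.castSucc_zero, Fin.snoc_castSucc]
    · rw [Fin.snoc_last, h1, lieStep_succ]
    · intro ℓ
      refine Fin.lastCases ?_ (fun ℓ => ?_) ℓ
      · rw [Fin.succ_last, Fin.snoc_last, Fin.snoc_castSucc, Fin.snoc_last]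
        refine ⟨hz, ?_⟩
        rw [sub_eq_iff_eq_add, ← sub_eq_iff_eq_add']; exact hz'
      · rw [Fin.succ_castSucc, Fin.snoc_castSucc, Fin.snoc_castSucc, Fin.snoc_castSucc]
        exact h2 ℓ

theorem sum_succ_sub_castSucc {G : Type*} [AddCommGroup G] {s : ℕ} (v : Fin (s + 1) → G) :
    ∑ ℓ : Fin s, (v ℓ.succ - v ℓ.castSucc) = v (Fin.last s) - v 0 := by
  have h := (Fin.sum_univ_succ v).symm.trans (Fin.sum_univ_castSucc v)
  rw [Finset.sum_sub_distrib, sub_eq_sub_iff_add_eq_add, add_comm, h, add_comm]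

/-- The telescoping identity behind the consistency estimate, for a chain `v` with increments
`h • w ℓ`. -/
theorem sum_inner_chain {s : ℕ} {h : ℝ} {v : Fin (s + 1) → H} {w : Fin s → H}
    (hv : ∀ ℓ, v ℓ.succ - v ℓ.castSucc = h • w ℓ) :
    h * ∑ ℓ, ⟪w ℓ, v ℓ.succ - v 0⟫_ℝ =
      ‖v (Fin.last s) - v 0‖ ^ 2 / 2 + h ^ 2 / 2 * ∑ ℓ, ‖w ℓ‖ ^ 2 := by
  induction s with
  | zero => simp
  | succ s ih =>
    have h1 := ih (v := fun i => v i.castSucc) (w := fun ℓ => w ℓ.castSucc)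
      (fun ℓ => by rw [← hv ℓ.castSucc, Fin.succ_castSucc])
    rw [Fin.sum_univ_castSucc, Fin.sum_univ_castSucc, mul_add, mul_add]
    simp only [Fin.succ_castSucc, Fin.succ_last, Fin.castSucc_zero] at h1 ⊢
    rw [h1]
    have h2 := hv (Fin.last s)
    rw [Fin.succ_last] at h2
    set a := v (Fin.last (s + 1)) - v 0
    set b := v (Fin.last s).castSucc - v 0
    have h3 : h • w (Fin.last s) = a - b := by rw [← h2]; simp only [a, b]; abel
    have h4 : h * ⟪w (Fin.last s), a⟫_ℝ = ⟪a - b, a⟫_ℝ := by rw [← h3, real_inner_smul_left]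
    have h5 : h ^ 2 * ‖w (Fin.last s)‖ ^ 2 = ‖a - b‖ ^ 2 := by
      rw [← h3, norm_smul, mul_pow, Real.norm_eq_abs, sq_abs]
    have h6 := norm_sub_sq_real a b
    rw [inner_sub_left, real_inner_self_eq_norm_sq, real_inner_comm a b] at h4
    linarith

theorem norm_sub_le_of_chain {s : ℕ} {h : ℝ} (hh : 0 ≤ h) {v : Fin (s + 1) → H} {w : Fin s → H}
    (hv : ∀ ℓ, v ℓ.succ - v ℓ.castSucc = h • w ℓ) (i : Fin (s + 1)) :
    ‖v i - v 0‖ ≤ h * ∑ ℓ, ‖w ℓ‖ := by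
  induction s with
  | zero => rw [Fin.fin_one_eq_zero i]; simp
  | succ s ih =>
    have h1 := ih (v := fun i => v i.castSucc) (w := fun ℓ => w ℓ.castSucc)
      (fun ℓ => by rw [← hv ℓ.castSucc, Fin.succ_castSucc])
    rw [Fin.sum_univ_castSucc, mul_add]
    have h2 : 0 ≤ h * ‖w (Fin.last s)‖ := mul_nonneg hh (norm_nonneg _)
    refine Fin.lastCases ?_ (fun i => ?_) i
    · have h3 := hv (Fin.last s)
      rw [Fin.succ_last] at h3
      have h4 : ‖v (Fin.last (s + 1)) - v (Fin.last s).castSucc‖ = h * ‖w (Fin.last s)‖ := by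
        rw [h3, norm_smul, Real.norm_of_nonneg hh]
      have h5 := norm_sub_le_norm_sub_add_norm_sub (v (Fin.last (s + 1)))
        (v (Fin.last s).castSucc) (v 0)
      have h6 := h1 (Fin.last s)
      simp only [Fin.castSucc_zero] at h6
      linarith
    · have h6 := h1 i
      simp only [Fin.castSucc_zero] at h6
      linarith

/-- The strong consistency estimate: the resolvents of the quotients of the Lie steps converge with
rate `√h` at every point where the resolvent of the sum takes values in all of the domains. The
quadratic terms of the telescoping sum `sum_inner_chain` absorb the commutation error, so that no
weak limits occur. -/
theorem norm_resolventMap_lieStep_sub_sq_le [CompleteSpace H] {s : ℕ} {A : Fin s → Set (H × H)}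
    (hA : ∀ ℓ, IsMDissipative (A ℓ)) {h l : ℝ} (hh : 0 < h) (hl : 0 < l) {u x : H} {a : Fin s → H}
    (ha : ∀ ℓ, (u, a ℓ) ∈ A ℓ) (hx : u - l • ∑ ℓ, a ℓ = x) :
    ‖resolventMap (quotientGraph (lieStep A h) h) l x - u‖ ^ 2 ≤
      l * h * (s * (∑ ℓ, ‖a ℓ‖) ^ 2 / 2) := by
  have hQ := isMDissipative_quotientGraph (fun x y => norm_lieStep_sub_le hA hh x y) hh
  obtain ⟨z, hz, hzx⟩ := hQ.solves hl x
  set y := resolventMap (quotientGraph (lieStep A h) h) l x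
  obtain ⟨v, w, h0, h1, h2⟩ := exists_lieStep_chain hA hh y
  have hv : ∀ ℓ, v ℓ.succ - v ℓ.castSucc = h • w ℓ := fun ℓ => (h2 ℓ).2
  have hzw : z = ∑ ℓ, w ℓ := by
    change z = h⁻¹ • (lieStep A h y - y) at hz
    have e : v (Fin.last s) - v 0 = h • ∑ ℓ, w ℓ := by
      rw [Finset.smul_sum, ← sum_succ_sub_castSucc v]
      exact Finset.sum_congr rfl fun ℓ _ => hv ℓ
    rw [hz, ← h1, ← h0, e, inv_smul_smul₀ hh.ne']
  set M := ∑ ℓ, ‖a ℓ‖ with hM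
  set S := ∑ ℓ, ‖w ℓ‖ with hS
  have d1 : ∑ ℓ, ⟪w ℓ - a ℓ, v ℓ.succ - u⟫_ℝ ≤ 0 :=
    Finset.sum_nonpos fun ℓ _ => (hA ℓ).1 _ (h2 ℓ).1 _ (ha ℓ)
  have d2 : ∑ ℓ, ⟪w ℓ - a ℓ, v ℓ.succ - u⟫_ℝ = ⟪∑ ℓ, w ℓ - ∑ ℓ, a ℓ, y - u⟫_ℝ +
      ∑ ℓ, ⟪w ℓ, v ℓ.succ - v 0⟫_ℝ - ∑ ℓ, ⟪a ℓ, v ℓ.succ - v 0⟫_ℝ := by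
    rw [← Finset.sum_sub_distrib, sum_inner, ← Finset.sum_add_distrib, ← Finset.sum_sub_distrib]
    refine Finset.sum_congr rfl fun ℓ _ => ?_
    rw [show v ℓ.succ - u = (y - u) + (v ℓ.succ - v 0) by rw [h0]; abel, inner_add_right,
      inner_sub_left (w ℓ) (a ℓ) (v ℓ.succ - v 0)]
    ring
  -- the resolvent equations of `y` and `u` have the same right-hand side
  have d3 : l * ⟪∑ ℓ, w ℓ - ∑ ℓ, a ℓ, y - u⟫_ℝ = ‖y - u‖ ^ 2 := by
    rw [← real_inner_smul_left, ← hzw, ← real_inner_self_eq_norm_sq]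
    congr 1
    rw [← hx] at hzx
    rw [smul_sub, sub_eq_iff_eq_add.1 hzx]
    abel
  have d4 : ∑ ℓ, ⟪a ℓ, v ℓ.succ - v 0⟫_ℝ ≤ M * (h * S) := by
    rw [hM, Finset.sum_mul]
    refine Finset.sum_le_sum fun ℓ _ => (real_inner_le_norm _ _).trans ?_
    gcongr
    exact norm_sub_le_of_chain hh.le hv _
  have d5 := sum_inner_chain hv
  -- Young's inequality, to absorb the term by the quadratic part of `d5`
  have d6 : M * S ≤ (∑ ℓ, ‖w ℓ‖ ^ 2) / 2 + s * M ^ 2 / 2 := by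
    have : ∑ _ℓ : Fin s, M ^ 2 / 2 = s * M ^ 2 / 2 := by simp; ring
    rw [← this, Finset.sum_div, ← Finset.sum_add_distrib, hS, Finset.mul_sum]
    refine Finset.sum_le_sum fun ℓ _ => ?_
    nlinarith [sq_nonneg (M - ‖w ℓ‖)]
  have d7 : h / 2 * ∑ ℓ, ‖w ℓ‖ ^ 2 ≤ ∑ ℓ, ⟪w ℓ, v ℓ.succ - v 0⟫_ℝ := by
    refine le_of_mul_le_mul_left ?_ hh
    rw [d5]
    nlinarith [sq_nonneg ‖v (Fin.last s) - v 0‖]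
  have d8 := mul_le_mul_of_nonneg_left d6 hh.le
  have d9 : ⟪∑ ℓ, w ℓ - ∑ ℓ, a ℓ, y - u⟫_ℝ ≤ h * (s * M ^ 2 / 2) := by
    linarith
  rw [← d3, mul_assoc]
  exact mul_le_mul_of_nonneg_left d9 hl.le

/-- The Lie splitting of `A` into the operators `B ℓ` converges, if on a dense set the resolvents of
`A` take values in the domains of all `B ℓ`, where `A = ∑ B ℓ`. -/
theorem IsMDissipative.tendstoUniformlyOn_lieStep [CompleteSpace H] {A : Set (H × H)}
    (hA : IsMDissipative A) (hdom : Dense (dom A)) {s : ℕ} {B : Fin s → Set (H × H)}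
    (hB : ∀ ℓ, IsMDissipative (B ℓ)) {D : Set H} (hD : Dense D)
    (hsum : ∀ l : ℝ, 0 < l → ∀ x ∈ D, ∃ (u : H) (a : Fin s → H), (∀ ℓ, (u, a ℓ) ∈ B ℓ) ∧
      (u, ∑ ℓ, a ℓ) ∈ A ∧ u - l • ∑ ℓ, a ℓ = x) (η : H) (T : ℝ) :
    TendstoUniformlyOn (fun (n : ℕ) (t : ℝ) => (lieStep B (t / n))^[n] η)
      (fun t => expMap A t η) atTop (Ioo 0 T) := by
  refine hA.tendstoUniformlyOn_iterate hdom (fun h hh => norm_lieStep_sub_le hB hh) ?_ η T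
  intro l hl x
  have hQ : ∀ h, 0 < h → IsMDissipative (quotientGraph (lieStep B h) h) := fun h hh =>
    isMDissipative_quotientGraph (norm_lieStep_sub_le hB hh) hh
  rw [Metric.tendsto_nhds]
  intro ε hε
  obtain ⟨y, hyx, hy⟩ := Metric.dense_iff.1 hD x (ε / 3) (by positivity)
  rw [Metric.mem_ball, dist_eq_norm] at hyx
  obtain ⟨u, a, ha, hu, huy⟩ := hsum l hl y hy
  have huJ : resolventMap A l y = u := hA.resolventMap_eq hl ⟨_, hu, huy⟩
  have hlim : Tendsto (fun h : ℝ => l * h * (s * (∑ ℓ, ‖a ℓ‖) ^ 2 / 2)) (𝓝[>] 0) (𝓝 0) := by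
    have : Continuous fun h : ℝ => l * h * (s * (∑ ℓ, ‖a ℓ‖) ^ 2 / 2) := by fun_prop
    simpa using this.continuousWithinAt (s := Ioi (0 : ℝ)) (x := 0) |>.tendsto
  filter_upwards [hlim.eventually (gt_mem_nhds (show 0 < (ε / 3) ^ 2 by positivity)),
    self_mem_nhdsWithin] with h h1 hh
  have e1 := (norm_resolventMap_lieStep_sub_sq_le hB hh hl ha huy).trans_lt h1
  have e2 := lt_of_pow_lt_pow_left₀ 2 (by positivity) e1
  have e3 := (hQ h hh).norm_resolventMap_sub_le hl y x
  have e4 := hA.norm_resolventMap_sub_le hl y x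
  rw [huJ] at e4
  have e5 := dist_triangle4 (resolventMap (quotientGraph (lieStep B h) h) l x)
    (resolventMap (quotientGraph (lieStep B h) h) l y) u (resolventMap A l x)
  simp only [← dist_eq_norm] at *
  rw [dist_comm] at e3
  linarith

end Lie

/-! ### Monotone equations in uniformly convex spaces -/

section Minty

variable {E : Type*} [NormedAddCommGroup E] [NormedSpace ℝ E]

/-- The functional `Φ` is nonnegative and uniformly convex at midpoints, on its sublevel sets. -/
def IsUniformlyConvexFunctional (Φ : E → ℝ) : Prop :=
  (∀ x, 0 ≤ Φ x) ∧ ∀ R ε : ℝ, 0 < ε → ∃ γ > 0, ∀ x y, Φ x ≤ R → Φ y ≤ R →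
    (Φ x + Φ y) / 2 - Φ ((1 / 2 : ℝ) • (x + y)) < γ → ‖x - y‖ < ε

/-- Weak compactness in the form in which it is used here: closed convex sets have a common point,
if finitely many of them always meet in a given sublevel set of a uniformly convex functional. The
almost minimizers of the functional over the finite intersections form a Cauchy net. -/
theorem exists_mem_of_finite_inter [CompleteSpace E] {Φ : E → ℝ}
    (hΦ : IsUniformlyConvexFunctional Φ) {ι : Type*} {C : ι → Set E} (hclosed : ∀ i, IsClosed (C i))
    (hconv : ∀ i, Convex ℝ (C i)) {R : ℝ}
    (hfin : ∀ s : Finset ι, ∃ x, (∀ i ∈ s, x ∈ C i) ∧ Φ x ≤ R) : ∃ x, ∀ i, x ∈ C i := by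
  classical
  let K : Finset ι → Set ℝ := fun s => Φ '' {x | ∀ i ∈ s, x ∈ C i}
  let m : Finset ι → ℝ := fun s => sInf (K s)
  have hKbdd : ∀ s, BddBelow (K s) := fun s => ⟨0, by rintro _ ⟨x, _, rfl⟩; exact hΦ.1 x⟩
  have hKne : ∀ s, (K s).Nonempty := fun s => by
    obtain ⟨x, hx, _⟩ := hfin s
    exact ⟨_, x, hx, rfl⟩
  have hm : ∀ s x, (∀ i ∈ s, x ∈ C i) → m s ≤ Φ x := fun s x hx => csInf_le (hKbdd s) ⟨x, hx, rfl⟩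
  have hmR : ∀ s, m s ≤ R := fun s => by
    obtain ⟨x, hx, hxR⟩ := hfin s
    exact (hm s x hx).trans hxR
  have hmbdd : BddAbove (range m) := ⟨R, by rintro _ ⟨s, rfl⟩; exact hmR s⟩
  set M := ⨆ s, m s with hM
  have hmM : ∀ s, m s ≤ M := fun s => le_ciSup hmbdd s
  have hMR : M ≤ R := ciSup_le hmR
  have hex : ∀ q : Finset ι × ℕ, ∃ x, (∀ i ∈ q.1, x ∈ C i) ∧ Φ x < M + 1 / ((q.2 : ℝ) + 1) := by
    intro q
    have h1 : m q.1 < M + 1 / ((q.2 : ℝ) + 1) := by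
      have : 0 < 1 / ((q.2 : ℝ) + 1) := by positivity
      linarith [hmM q.1]
    obtain ⟨_, ⟨x, hx, rfl⟩, h2⟩ := exists_lt_of_csInf_lt (hKne q.1) h1
    exact ⟨x, hx, h2⟩
  choose x hxC hxΦ using hex
  have hcau : CauchySeq x := by
    rw [Metric.cauchySeq_iff]
    intro ε hε
    obtain ⟨γ, hγ, hγε⟩ := hΦ.2 (R + 1) ε hε
    obtain ⟨s, hs⟩ := exists_lt_of_lt_ciSup (show M - γ / 2 < ⨆ s, m s by rw [← hM]; linarith)
    obtain ⟨N, hN⟩ := exists_nat_one_div_lt (half_pos hγ)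
    have key : ∀ q : Finset ι × ℕ, (s, N) ≤ q → Φ (x q) < M + γ / 2 ∧ Φ (x q) ≤ R + 1 ∧
        ∀ i ∈ s, x q ∈ C i := by
      intro q hq
      have h1 : 1 / ((q.2 : ℝ) + 1) ≤ 1 / ((N : ℝ) + 1) := by
        have : (N : ℝ) ≤ q.2 := by exact_mod_cast hq.2
        gcongr
      have h2 : 1 / ((q.2 : ℝ) + 1) ≤ 1 := by
        rw [div_le_one (by positivity)]
        linarith [show (0 : ℝ) ≤ q.2 from Nat.cast_nonneg _]
      have h3 := hxΦ q
      exact ⟨by linarith, by linarith, fun i hi => hxC q i (hq.1 hi)⟩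
    refine ⟨(s, N), fun q hq r hr => ?_⟩
    obtain ⟨a1, a2, a3⟩ := key q hq
    obtain ⟨b1, b2, b3⟩ := key r hr
    rw [dist_eq_norm]
    refine hγε _ _ a2 b2 ?_
    have h4 : m s ≤ Φ ((1 / 2 : ℝ) • (x q + x r)) := by
      refine hm s _ fun i hi => ?_
      rw [smul_add]
      exact hconv i (a3 i hi) (b3 i hi) (by norm_num) (by norm_num) (by norm_num)
    linarith
  obtain ⟨y, hy⟩ := cauchySeq_tendsto_of_complete hcau
  refine ⟨y, fun i => (hclosed i).mem_of_tendsto hy ?_⟩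
  filter_upwards [eventually_ge_atTop (({i} : Finset ι), 0)] with q hq
  exact hxC q i (hq.1 (Finset.mem_singleton_self i))

/-- In a matrix game whose payoffs satisfy `0 ≤ M i j + M j i`, the column player has a strategy
with nonnegative payoffs. By separation, the alternative is a strategy `c` with `c ⬝ M c < 0`. -/
theorem exists_stdSimplex_sum_nonneg {ι : Type*} [Fintype ι] [Nonempty ι] (M : ι → ι → ℝ)
    (hM : ∀ i j, 0 ≤ M i j + M j i) :
    ∃ c ∈ stdSimplex ℝ ι, ∀ i, 0 ≤ ∑ j, c j * M i j := by
  classical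
  by_contra! hcon
  let L : (ι → ℝ) →ₗ[ℝ] (ι → ℝ) := Matrix.mulVecLin (Matrix.of M)
  have hL : ∀ c i, L c i = ∑ j, c j * M i j := fun c i => by
    simp [L, Matrix.mulVec, dotProduct, mul_comm]
  have hdisj : Disjoint (L '' stdSimplex ℝ ι) {y | ∀ i, 0 ≤ y i} := by
    rw [Set.disjoint_left]
    rintro _ ⟨c, hc, rfl⟩ h
    obtain ⟨i, hi⟩ := hcon c hc
    have := h i
    rw [hL] at this
    linarith
  have hcl : IsClosed {y : ι → ℝ | ∀ i, 0 ≤ y i} := by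
    simp only [ofPred_forall]
    exact isClosed_iInter fun i => isClosed_le continuous_const (continuous_apply i)
  have hcv : Convex ℝ {y : ι → ℝ | ∀ i, 0 ≤ y i} := by
    intro x hx y hy a b ha hb _ i
    exact add_nonneg (mul_nonneg ha (hx i)) (mul_nonneg hb (hy i))
  obtain ⟨f, u, v, hfu, huv, hfv⟩ := geometric_hahn_banach_compact_closed
    ((convex_stdSimplex ℝ ι).linear_image L) ((isCompact_stdSimplex ℝ ι).image
      L.continuous_of_finiteDimensional) hcv hcl hdisj
  have hv0 : v < 0 := by simpa using hfv 0 (fun i => le_rfl)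
  let c : ι → ℝ := fun i => f (Pi.single i 1)
  have hf : ∀ y, f y = ∑ i, y i * c i := fun y => by
    conv_lhs => rw [pi_eq_sum_univ' y]
    simp [c]
  -- `f` is bounded below on the positive cone
  have hc0 : ∀ i, 0 ≤ c i := by
    intro i
    by_contra! hi
    have := hfv (Pi.single i (v / c i)) (fun j => by
      rcases eq_or_ne j i with rfl | hj
      · simpa using (div_pos_of_neg_of_neg hv0 hi).le
      · simp [hj])
    rw [hf, Finset.sum_eq_single i (fun j _ hj => by simp [hj]) (by simp)] at this
    rw [Pi.single_eq_same, div_mul_cancel₀ _ hi.ne] at this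
    exact lt_irrefl _ this
  have hneg : ∀ c' ∈ stdSimplex ℝ ι, ∑ i, (∑ j, c' j * M i j) * c i < 0 := by
    intro c' hc'
    have := hfu (L c') ⟨c', hc', rfl⟩
    rw [hf] at this
    simp only [hL] at this
    linarith
  set S := ∑ i, c i with hS
  have hS0 : 0 ≤ S := Finset.sum_nonneg fun i _ => hc0 i
  rcases hS0.eq_or_lt with h0 | h0
  · have hcz : ∀ i, c i = 0 := fun i =>
      (Finset.sum_eq_zero_iff_of_nonneg fun i _ => hc0 i).1 h0.symm i (Finset.mem_univ i)
    obtain ⟨i⟩ := ‹Nonempty ι›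
    have := hneg _ (single_mem_stdSimplex ℝ i)
    simp [hcz] at this
  · have h1 := hneg (fun i => c i / S) ⟨fun i => div_nonneg (hc0 i) hS0, by
      rw [← Finset.sum_div, div_self h0.ne']⟩
    have h2 : ∑ i, (∑ j, c j / S * M i j) * c i = (∑ i, ∑ j, c i * c j * M i j) / S := by
      rw [Finset.sum_div]
      refine Finset.sum_congr rfl fun i _ => ?_
      rw [Finset.sum_mul, Finset.sum_div]
      exact Finset.sum_congr rfl fun j _ => by ring
    have h3 : ∑ i, ∑ j, c i * c j * M i j = ∑ i, ∑ j, c i * c j * M j i := by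
      rw [Finset.sum_comm]
      exact Finset.sum_congr rfl fun i _ => Finset.sum_congr rfl fun j _ => by ring
    have h4 : 0 ≤ ∑ i, ∑ j, c i * c j * M i j + ∑ i, ∑ j, c i * c j * M j i := by
      rw [← Finset.sum_add_distrib]
      refine Finset.sum_nonneg fun i _ => ?_
      rw [← Finset.sum_add_distrib]
      refine Finset.sum_nonneg fun j _ => ?_
      rw [← mul_add]
      exact mul_nonneg (mul_nonneg (hc0 i) (hc0 j)) (hM i j)
    rw [h2, div_lt_iff₀ h0, zero_mul] at h1
    linarith

/-- The theorem of Browder and Minty on a closed subspace `G`. Monotonicity makes the finite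
intersections of the half spaces `0 ≤ a w (w - u)` nonempty (by `exists_stdSimplex_sum_nonneg`,
over convex combinations of the points `w`); a common point in a large ball is a solution, by
hemicontinuity and coercivity. -/
theorem exists_eq_zero_of_monotone [CompleteSpace E] {Φ : E → ℝ}
    (hΦ : IsUniformlyConvexFunctional Φ) (hbdd : ∀ R, ∃ R', ∀ x, ‖x‖ ≤ R → Φ x ≤ R')
    {G : Submodule ℝ E} (hG : IsClosed (G : Set E)) (a : E → StrongDual ℝ E)
    (hmono : ∀ x y, 0 ≤ (a x - a y) (x - y))
    (hhemi : ∀ x y z, Tendsto (fun t : ℝ => a (x + t • y) z) (𝓝[>] 0) (𝓝 (a x z)))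
    (hcoer : ∃ R, ∀ x, R ≤ ‖x‖ → 0 < a x x) : ∃ x ∈ G, ∀ y ∈ G, a x y = 0 := by
  obtain ⟨R₀, hR₀⟩ := hcoer
  set R := max R₀ 1 with hR
  have hRpos : 0 < R := lt_of_lt_of_le one_pos (le_max_right _ _)
  have hcoer : ∀ x, R ≤ ‖x‖ → 0 < a x x := fun x hx => hR₀ x ((le_max_left _ _).trans hx)
  let B : Set E := (G : Set E) ∩ Metric.closedBall 0 R
  have hBcl : IsClosed B := hG.inter Metric.isClosed_closedBall
  have hBcv : Convex ℝ B := G.convex.inter (convex_closedBall 0 R)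
  have hB0 : (0 : E) ∈ B := ⟨G.zero_mem, Metric.mem_closedBall_self hRpos.le⟩
  obtain ⟨R', hR'⟩ := hbdd R
  let C : B → Set E := fun w => B ∩ {u | 0 ≤ a w (w - u)}
  obtain ⟨x, hx⟩ : ∃ x, ∀ w : B, x ∈ C w := by
    refine exists_mem_of_finite_inter hΦ (R := R') (fun w => hBcl.inter ?_) (fun w => hBcv.inter ?_)
      fun s => ?_
    · exact isClosed_le continuous_const
        ((a w).continuous.comp (continuous_const.sub continuous_id))
    · intro u hu v hv b c hb hc hbc
      change 0 ≤ a w (w - (b • u + c • v))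
      have : (w : E) - (b • u + c • v) = b • ((w : E) - u) + c • ((w : E) - v) := by
        rw [smul_sub, smul_sub, sub_add_sub_comm, ← add_smul, hbc, one_smul]
      rw [this, map_add, map_smul, map_smul]
      exact add_nonneg (mul_nonneg hb hu) (mul_nonneg hc hv)
    · rcases s.eq_empty_or_nonempty with rfl | hs
      · exact ⟨0, by simp, hR' 0 (by simpa using hRpos.le)⟩
      have : Nonempty s := hs.to_subtype
      obtain ⟨c, hc, hc'⟩ := exists_stdSimplex_sum_nonneg
        (fun i j : s => a (i : B) (((i : B) : E) - ((j : B) : E))) (fun i j => by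
          have := hmono ((i : B) : E) ((j : B) : E)
          rw [sub_apply, sub_eq_add_neg, ← map_neg, neg_sub] at this
          exact this)
      let u : E := ∑ j : s, c j • ((j : B) : E)
      have huB : u ∈ B := hBcv.sum_mem (fun j _ => hc.1 j) hc.2 fun j _ => (j : B).2
      refine ⟨u, fun w hw => ⟨huB, ?_⟩, hR' u (by simpa using huB.2)⟩
      have h1 := hc' ⟨w, hw⟩
      have h2 : (w : E) - u = ∑ j : s, c j • ((w : E) - ((j : B) : E)) := by
        simp only [smul_sub, Finset.sum_sub_distrib, ← Finset.sum_smul, hc.2, one_smul, u]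
      change 0 ≤ a w (w - u)
      rw [h2, map_sum]
      simpa only [map_smul, smul_eq_mul] using h1
  have hxB : x ∈ B := (hx ⟨0, hB0⟩).1
  -- Minty's trick: test with `x + t (w - x)` and let `t → 0`
  have hminty : ∀ w ∈ B, 0 ≤ a x (w - x) := by
    intro w hw
    refine ge_of_tendsto (hhemi x (w - x) (w - x)) ?_
    filter_upwards [Ioo_mem_nhdsGT one_pos] with t ht
    have hmem : x + t • (w - x) ∈ B :=
      hBcv.add_smul_sub_mem hxB hw ⟨ht.1.le, ht.2.le⟩
    have h1 : 0 ≤ a (x + t • (w - x)) (x + t • (w - x) - x) := (hx ⟨_, hmem⟩).2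
    rw [add_sub_cancel_left, map_smul, smul_eq_mul] at h1
    exact nonneg_of_mul_nonneg_right h1 ht.1
  have hxR : ‖x‖ < R := by
    by_contra! h
    have h1 := hminty 0 hB0
    rw [zero_sub, map_neg] at h1
    linarith [hcoer x h]
  -- as `x` is an interior point of the ball, all directions in `G` are admissible
  have hpos : ∀ y ∈ G, 0 ≤ a x y := by
    intro y hy
    have hnear : ∀ᶠ t : ℝ in 𝓝[>] 0, ‖x + t • y‖ < R := by
      have hcont : Continuous fun t : ℝ => ‖x + t • y‖ := by fun_prop
      have := hcont.tendsto 0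
      rw [zero_smul, add_zero] at this
      exact nhdsWithin_le_nhds (this.eventually (gt_mem_nhds hxR))
    obtain ⟨t, ht, ht0⟩ := (hnear.and self_mem_nhdsWithin).exists
    have h1 := hminty (x + t • y) ⟨G.add_mem hxB.1 (G.smul_mem t hy), by simpa using ht.le⟩
    rw [add_sub_cancel_left, map_smul, smul_eq_mul] at h1
    exact nonneg_of_mul_nonneg_right h1 ht0
  refine ⟨x, hxB.1, fun y hy => le_antisymm ?_ (hpos y hy)⟩
  have := hpos (-y) (G.neg_mem hy)
  rw [map_neg] at this
  linarith

end Minty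

/-! ### Uniform convexity of the `p`-th power of the norm -/

section PowerNorm

variable {F : Type*} [NormedAddCommGroup F] {p : ℝ} {X : Type*} [MeasurableSpace X] {μ : Measure X}

theorem norm_rpow_eq_integral (hp : 0 < p) (U : Lp F (ENNReal.ofReal p) μ) :
    ‖U‖ ^ p = ∫ x, ‖U x‖ ^ p ∂μ := by
  have h0 : 0 ≤ ∫ x, ‖U x‖ ^ p ∂μ := integral_nonneg fun x => by positivity
  rw [Lp.norm_def, (Lp.memLp U).eLpNorm_eq_integral_rpow_norm (by simpa using hp)
    ENNReal.ofReal_ne_top, ENNReal.toReal_ofReal hp.le, ENNReal.toReal_ofReal (by positivity),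
    Real.rpow_inv_rpow h0 hp.ne']

theorem integrable_norm_rpow_ofReal (hp : 0 < p) {U : X → F} (hU : MemLp U (ENNReal.ofReal p) μ) :
    Integrable (fun x => ‖U x‖ ^ p) μ := by
  simpa only [ENNReal.toReal_ofReal hp.le] using
    hU.integrable_norm_rpow (by simpa using hp) ENNReal.ofReal_ne_top

/-- The functional `‖u‖² + ‖U‖^p` on `H × L^p(μ)`. -/
def energyFunctional (H : Type*) [NormedAddCommGroup H] (F : Type*) [NormedAddCommGroup F] (p : ℝ)
    (μ : Measure X) (q : H × Lp F (ENNReal.ofReal p) μ) : ℝ :=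
  ‖q.1‖ ^ 2 + ‖q.2‖ ^ p

theorem exists_energyFunctional_le (hp : 0 < p) {H : Type*} [NormedAddCommGroup H]
    [Fact (1 ≤ ENNReal.ofReal p)] (R : ℝ) :
    ∃ R', ∀ q : H × Lp F (ENNReal.ofReal p) μ, ‖q‖ ≤ R → energyFunctional H F p μ q ≤ R' := by
  refine ⟨R ^ 2 + R ^ p, fun q hq => ?_⟩
  have h1 : ‖q.1‖ ≤ R := (norm_fst_le q).trans hq
  have h2 : ‖q.2‖ ≤ R := (norm_snd_le q).trans hq
  unfold energyFunctional
  gcongr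

end PowerNorm

section UniformConvexity

variable {F : Type*} [NormedAddCommGroup F] [InnerProductSpace ℝ F] {p : ℝ}

/-- The gap in the midpoint convexity inequality for `‖·‖ ^ p`. -/
def midpointGap (p : ℝ) (a b : F) : ℝ :=
  (‖a‖ ^ p + ‖b‖ ^ p) / 2 - ‖(1 / 2 : ℝ) • (a + b)‖ ^ p

theorem midpointGap_pos (hp : 1 < p) {a b : F} (hab : a ≠ b) : 0 < midpointGap p a b := by
  have hp0 : 0 < p := one_pos.trans hp
  rw [midpointGap, sub_pos]
  by_cases h : ‖a‖ = ‖b‖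
  · have h1 : ‖(1 / 2 : ℝ) • (a + b)‖ < ‖a‖ := by
      rw [smul_add]
      exact norm_combo_lt_of_ne le_rfl h.ge hab (by norm_num) (by norm_num) (by norm_num)
    refine (Real.rpow_lt_rpow (norm_nonneg _) h1 hp0).trans_eq ?_
    rw [← h]; ring
  · have h1 : ‖(1 / 2 : ℝ) • (a + b)‖ ≤ (1 / 2 : ℝ) * ‖a‖ + (1 / 2 : ℝ) * ‖b‖ := by
      rw [norm_smul, Real.norm_of_nonneg (by norm_num), ← mul_add]
      gcongr
      exact norm_add_le a b
    have h2 := (strictConvexOn_rpow hp).2 (norm_nonneg a) (norm_nonneg b) h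
      (show (0 : ℝ) < 1 / 2 by norm_num) (show (0 : ℝ) < 1 / 2 by norm_num) (by norm_num)
    simp only [smul_eq_mul] at h2
    refine (Real.rpow_le_rpow (norm_nonneg _) h1 hp0.le).trans_lt (h2.trans_eq ?_)
    ring

theorem midpointGap_nonneg (hp : 1 < p) (a b : F) : 0 ≤ midpointGap p a b := by
  rcases eq_or_ne a b with rfl | h
  · rw [midpointGap, ← two_smul ℝ a, smul_smul]
    norm_num
  · exact (midpointGap_pos hp h).le

/-- Uniform convexity in a form that can be integrated. By homogeneity it suffices to consider
`‖a‖ ^ p + ‖b‖ ^ p = 1`, where it holds by compactness and strict convexity, for every `p > 1`. -/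
theorem exists_norm_sub_rpow_le [FiniteDimensional ℝ F] (hp : 1 < p) {ε : ℝ} (hε : 0 < ε) :
    ∃ C > 0, ∀ a b : F, ‖a - b‖ ^ p ≤ ε * (‖a‖ ^ p + ‖b‖ ^ p) + C * midpointGap p a b := by
  have hp0 : 0 < p := one_pos.trans hp
  have hcont : ∀ f : F × F → F, Continuous f → Continuous fun q => ‖f q‖ ^ p := fun f hf =>
    hf.norm.rpow_const fun _ => Or.inr hp0.le
  have c1 := hcont Prod.fst continuous_fst
  have c2 := hcont Prod.snd continuous_snd
  have c3 := hcont (fun q => q.1 - q.2) (by fun_prop)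
  have c4 := hcont (fun q => (1 / 2 : ℝ) • (q.1 + q.2)) (by fun_prop)
  let S : Set (F × F) := {q | ‖q.1‖ ^ p + ‖q.2‖ ^ p = 1} ∩ {q | ε ≤ ‖q.1 - q.2‖ ^ p}
  have hle : ∀ a b : F, ‖a‖ ^ p + ‖b‖ ^ p = 1 → ‖a‖ ≤ 1 ∧ ‖b‖ ≤ 1 := by
    intro a b hab
    have ha := Real.rpow_nonneg (norm_nonneg a) p
    have hb := Real.rpow_nonneg (norm_nonneg b) p
    constructor
    · rw [← Real.rpow_le_rpow_iff (norm_nonneg a) zero_le_one hp0, Real.one_rpow]; linarith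
    · rw [← Real.rpow_le_rpow_iff (norm_nonneg b) zero_le_one hp0, Real.one_rpow]; linarith
  have hS : IsCompact S := by
    refine Metric.isCompact_of_isClosed_isBounded
      ((isClosed_eq (c1.add c2) continuous_const).inter (isClosed_le continuous_const c3)) ?_
    refine (Metric.isBounded_closedBall (x := (0 : F × F)) (r := 1)).subset fun q hq => ?_
    rw [mem_closedBall_zero_iff]
    exact max_le (hle _ _ hq.1).1 (hle _ _ hq.1).2
  obtain ⟨m, hm, hmS⟩ := hS.exists_forall_le' (f := fun q : F × F => midpointGap p q.1 q.2)
    (Continuous.continuousOn (((c1.add c2).div_const 2).sub c4)) (a := 0) (by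
      rintro q ⟨_, hq⟩
      refine midpointGap_pos hp fun h => ?_
      rw [mem_ofPred_eq, h, sub_self, norm_zero, Real.zero_rpow hp0.ne'] at hq
      linarith)
  refine ⟨2 ^ p / m, by positivity, fun a b => ?_⟩
  -- the normalized case
  have key : ∀ a b : F, ‖a‖ ^ p + ‖b‖ ^ p = 1 →
      ‖a - b‖ ^ p ≤ ε + 2 ^ p / m * midpointGap p a b := by
    intro a b hab
    have hg := midpointGap_nonneg hp a b
    rcases le_total ε (‖a - b‖ ^ p) with h | h
    · have h1 : m ≤ midpointGap p a b := hmS (a, b) ⟨hab, h⟩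
      have h2 : ‖a - b‖ ^ p ≤ 2 ^ p := by
        refine Real.rpow_le_rpow (norm_nonneg _) ?_ hp0.le
        have := norm_sub_le a b
        linarith [(hle a b hab).1, (hle a b hab).2]
      have h3 : 2 ^ p ≤ 2 ^ p / m * midpointGap p a b := by
        rw [div_mul_eq_mul_div, le_div_iff₀ hm]
        gcongr
      linarith
    · have : 0 ≤ 2 ^ p / m * midpointGap p a b := by positivity
      linarith
  have ha := Real.rpow_nonneg (norm_nonneg a) p
  have hb := Real.rpow_nonneg (norm_nonneg b) p
  rcases (add_nonneg ha hb).eq_or_lt with h0 | h0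
  · have ha0 : ‖a‖ ^ p = 0 := by linarith
    have hb0 : ‖b‖ ^ p = 0 := by linarith
    rw [Real.rpow_eq_zero (norm_nonneg _) hp0.ne', norm_eq_zero] at ha0 hb0
    subst ha0 hb0
    simp [midpointGap, Real.zero_rpow hp0.ne']
  · set N := ‖a‖ ^ p + ‖b‖ ^ p with hN
    set r := N ^ p⁻¹ with hr
    have hr0 : 0 < r := Real.rpow_pos_of_pos h0 _
    have hrp : r ^ p = N := Real.rpow_inv_rpow h0.le hp0.ne'
    have hs : ∀ x : F, ‖x‖ ^ p = N * ‖r⁻¹ • x‖ ^ p := by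
      intro x
      rw [norm_smul, norm_inv, Real.norm_of_nonneg hr0.le, Real.mul_rpow (inv_pos.2 hr0).le
        (norm_nonneg _), Real.inv_rpow hr0.le, hrp, mul_inv_cancel_left₀ h0.ne']
    have h1 := key (r⁻¹ • a) (r⁻¹ • b) (by
      have := hN
      rw [hs a, hs b, ← mul_add] at this
      exact mul_left_cancel₀ h0.ne' (by rw [mul_one]; exact this.symm))
    have h2 : midpointGap p a b = N * midpointGap p (r⁻¹ • a) (r⁻¹ • b) := by
      rw [midpointGap, midpointGap, hs a, hs b, hs ((1 / 2 : ℝ) • (a + b)),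
        smul_comm r⁻¹ (1 / 2 : ℝ), smul_add r⁻¹]
      ring
    rw [hs (a - b), h2, smul_sub]
    calc N * ‖r⁻¹ • a - r⁻¹ • b‖ ^ p
        ≤ N * (ε + 2 ^ p / m * midpointGap p (r⁻¹ • a) (r⁻¹ • b)) := by gcongr
      _ = _ := by ring

variable {X : Type*} [MeasurableSpace X] {μ : Measure X}

theorem integral_midpointGap (hp : 0 < p) (U W : Lp F (ENNReal.ofReal p) μ) :
    Integrable (fun x => midpointGap p (U x) (W x)) μ ∧
      ∫ x, midpointGap p (U x) (W x) ∂μ =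
        (‖U‖ ^ p + ‖W‖ ^ p) / 2 - ‖(1 / 2 : ℝ) • (U + W)‖ ^ p := by
  have hU := integrable_norm_rpow_ofReal hp (Lp.memLp U)
  have hW := integrable_norm_rpow_ofReal hp (Lp.memLp W)
  have hM := integrable_norm_rpow_ofReal hp (Lp.memLp ((1 / 2 : ℝ) • (U + W)))
  have hUW : Integrable (fun x => ‖U x‖ ^ p + ‖W x‖ ^ p) μ := hU.add hW
  have hae : (fun x => midpointGap p (U x) (W x)) =ᵐ[μ]
      fun x => (‖U x‖ ^ p + ‖W x‖ ^ p) / 2 - ‖((1 / 2 : ℝ) • (U + W) : Lp F _ μ) x‖ ^ p := by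
    filter_upwards [Lp.coeFn_smul (1 / 2 : ℝ) (U + W), Lp.coeFn_add U W] with x h1 h2
    rw [midpointGap, h1, Pi.smul_apply, h2, Pi.add_apply]
  refine ⟨((hUW.div_const 2).sub hM).congr hae.symm, ?_⟩
  rw [integral_congr_ae hae, integral_sub (hUW.div_const 2) hM, integral_div,
    integral_add hU hW, norm_rpow_eq_integral hp, norm_rpow_eq_integral hp,
    norm_rpow_eq_integral hp]

/-- The `L^p` version of `exists_norm_sub_rpow_le`: the space `L^p(μ)` is uniformly convex. -/
theorem exists_Lp_norm_sub_rpow_le [FiniteDimensional ℝ F] (hp : 1 < p) {ε : ℝ} (hε : 0 < ε) :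
    ∃ C > 0, ∀ U W : Lp F (ENNReal.ofReal p) μ, ‖U - W‖ ^ p ≤ ε * (‖U‖ ^ p + ‖W‖ ^ p) +
      C * ((‖U‖ ^ p + ‖W‖ ^ p) / 2 - ‖(1 / 2 : ℝ) • (U + W)‖ ^ p) := by
  have hp0 : 0 < p := one_pos.trans hp
  obtain ⟨C, hC, h⟩ := exists_norm_sub_rpow_le (F := F) hp hε
  refine ⟨C, hC, fun U W => ?_⟩
  have hU := integrable_norm_rpow_ofReal hp0 (Lp.memLp U)
  have hW := integrable_norm_rpow_ofReal hp0 (Lp.memLp W)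
  have hUW : Integrable (fun x => ‖U x‖ ^ p + ‖W x‖ ^ p) μ := hU.add hW
  obtain ⟨hg, hg'⟩ := integral_midpointGap hp0 U W
  rw [← hg', norm_rpow_eq_integral hp0, norm_rpow_eq_integral hp0, norm_rpow_eq_integral hp0,
    ← integral_add hU hW, ← integral_const_mul, ← integral_const_mul,
    ← integral_add (hUW.const_mul ε) (hg.const_mul C)]
  refine integral_mono_ae (integrable_norm_rpow_ofReal hp0 (Lp.memLp (U - W)))
    ((hUW.const_mul ε).add (hg.const_mul C)) ?_
  filter_upwards [Lp.coeFn_sub U W] with x hx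
  rw [hx]
  exact h (U x) (W x)

theorem isUniformlyConvexFunctional_energyFunctional [FiniteDimensional ℝ F] (hp : 1 < p)
    [Fact (1 ≤ ENNReal.ofReal p)] {H : Type*} [NormedAddCommGroup H] [InnerProductSpace ℝ H] :
    IsUniformlyConvexFunctional (energyFunctional H F p μ) := by
  have hp0 : 0 < p := one_pos.trans hp
  refine ⟨fun q => by unfold energyFunctional; positivity, fun R ε hε => ?_⟩
  obtain ⟨C, hC, h⟩ := exists_Lp_norm_sub_rpow_le (F := F) (μ := μ) hp
    (show 0 < ε ^ p / (4 * (|R| + 1)) by positivity)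
  refine ⟨min (ε ^ 2 / 4) (ε ^ p / (2 * C)), by positivity, ?_⟩
  rintro ⟨u, U⟩ ⟨w, W⟩ hu hw hgap
  simp only [energyFunctional, Prod.mk_add_mk, Prod.smul_mk] at hu hw hgap
  have g1 : (‖u‖ ^ 2 + ‖w‖ ^ 2) / 2 - ‖(1 / 2 : ℝ) • (u + w)‖ ^ 2 = ‖u - w‖ ^ 2 / 4 := by
    have := parallelogram_law_with_norm ℝ u w
    rw [norm_smul, Real.norm_of_nonneg (by norm_num)]
    linarith
  have g2 : 0 ≤ (‖U‖ ^ p + ‖W‖ ^ p) / 2 - ‖(1 / 2 : ℝ) • (U + W)‖ ^ p := by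
    rw [← (integral_midpointGap hp0 U W).2]
    exact integral_nonneg fun x => midpointGap_nonneg hp _ _
  set g := (‖U‖ ^ p + ‖W‖ ^ p) / 2 - ‖(1 / 2 : ℝ) • (U + W)‖ ^ p with hg
  have hsum : ‖u - w‖ ^ 2 / 4 + g < min (ε ^ 2 / 4) (ε ^ p / (2 * C)) := by
    rw [← g1, hg]; linarith
  have e1 := hsum.trans_le (min_le_left _ _)
  have e2 := hsum.trans_le (min_le_right _ _)
  have k1 : ‖u - w‖ < ε := by
    refine lt_of_pow_lt_pow_left₀ 2 hε.le ?_
    linarith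
  have k2 : ‖U - W‖ < ε := by
    refine (Real.rpow_lt_rpow_iff (norm_nonneg _) hε.le hp0).1 ((h U W).trans_lt ?_)
    rw [← hg]
    have h1 : ‖U‖ ^ p + ‖W‖ ^ p ≤ 2 * (|R| + 1) := by
      linarith [le_abs_self R, sq_nonneg ‖u‖, sq_nonneg ‖w‖]
    have h2 : ε ^ p / (4 * (|R| + 1)) * (‖U‖ ^ p + ‖W‖ ^ p) ≤ ε ^ p / 2 := by
      calc ε ^ p / (4 * (|R| + 1)) * (‖U‖ ^ p + ‖W‖ ^ p)
          ≤ ε ^ p / (4 * (|R| + 1)) * (2 * (|R| + 1)) := by gcongr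
        _ = ε ^ p / 2 := by field_simp; norm_num
    have h3 : C * g < ε ^ p / 2 := by
      have h4 : g < ε ^ p / (2 * C) := by linarith [sq_nonneg ‖u - w‖]
      calc C * g < C * (ε ^ p / (2 * C)) := by gcongr
        _ = ε ^ p / 2 := by field_simp
    linarith
  exact max_lt k1 k2

end UniformConvexity

/-! ### Superposition operators -/

section Superposition

/-- A Carathéodory function maps measurable functions to measurable functions, as one sees by
approximation with simple functions. -/
theorem aestronglyMeasurable_superposition {F X : Type*} [NormedAddCommGroup F]
    [MeasurableSpace X] {μ : Measure X} {α : X → F → F} (hcont : ∀ᵐ x ∂μ, Continuous (α x))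
    (hmeas : ∀ z, AEStronglyMeasurable (fun x => α x z) μ) {U : X → F}
    (hU : AEStronglyMeasurable U μ) : AEStronglyMeasurable (fun x => α x (U x)) μ := by
  have hsimple : ∀ f : SimpleFunc X F, AEStronglyMeasurable (fun x => α x (f x)) μ := by
    intro f
    have : (fun x => α x (f x)) =
        fun x => ∑ z ∈ f.range, (f ⁻¹' {z}).indicator (fun x => α x z) x := by
      funext x
      rw [Finset.sum_eq_single (f x)]
      · simp
      · intro z _ hz
        exact indicator_of_notMem (fun h => hz (Eq.symm h)) _
      · intro h
        exact absurd (f.mem_range_self x) h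
    rw [this]
    exact Finset.aestronglyMeasurable_fun_sum _ fun z _ =>
      (hmeas z).indicator (f.measurableSet_preimage _)
  have hmk : AEStronglyMeasurable (fun x => α x (hU.mk U x)) μ := by
    refine aestronglyMeasurable_of_tendsto_ae atTop
      (fun n => hsimple (hU.stronglyMeasurable_mk.approx n)) ?_
    filter_upwards [hcont] with x hx
    exact (hx.tendsto _).comp (hU.stronglyMeasurable_mk.tendsto_approx x)
  refine hmk.congr ?_
  filter_upwards [hU.ae_eq_mk] with x hx
  rw [hx]

variable {F : Type*} [NormedAddCommGroup F] [InnerProductSpace ℝ F]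
  {X : Type*} [MeasurableSpace X] {μ : Measure X} {p : ℝ} {α : X → F → F}

/-- Carathéodory, growth, monotonicity and coercivity conditions for a general measure; the
exceptional null sets do not depend on the second argument. -/
structure IsMonotoneSuperposition (μ : Measure X) (p : ℝ) (α : X → F → F) (c₁ : ℝ) (c₂ : X → ℝ)
    (c₃ : ℝ) (c₄ : X → ℝ) : Prop where
  continuous : ∀ᵐ x ∂μ, Continuous (α x)
  measurable : ∀ z, AEStronglyMeasurable (fun x => α x z) μ
  c₁_pos : 0 < c₁
  memLp : MemLp c₂ (ENNReal.ofReal (p / (p - 1))) μ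
  growth : ∀ᵐ x ∂μ, ∀ z, ‖α x z‖ ≤ c₁ * ‖z‖ ^ (p - 1) + c₂ x
  monotone : ∀ᵐ x ∂μ, ∀ z z', 0 ≤ ⟪α x z - α x z', z - z'⟫_ℝ
  c₃_pos : 0 < c₃
  integrable : Integrable c₄ μ
  coercive : ∀ᵐ x ∂μ, ∀ z, c₃ * ‖z‖ ^ p - c₄ x ≤ ⟪α x z, z⟫_ℝ

theorem holderConjugate_ofReal (hp : 1 < p) :
    (ENNReal.ofReal (p / (p - 1))).HolderConjugate (ENNReal.ofReal p) :=
  (Real.HolderConjugate.conjExponent hp).symm.ennrealOfReal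

variable {c₁ c₃ : ℝ} {c₂ c₄ : X → ℝ}

namespace IsMonotoneSuperposition

theorem memLp_bound (hα : IsMonotoneSuperposition μ p α c₁ c₂ c₃ c₄) (hp : 1 < p) {U : X → F}
    (hU : MemLp U (ENNReal.ofReal p) μ) :
    MemLp (fun x => c₁ * ‖U x‖ ^ (p - 1) + c₂ x) (ENNReal.ofReal (p / (p - 1))) μ := by
  have h1 := hU.norm_rpow_div (ENNReal.ofReal (p - 1))
  rw [ENNReal.toReal_ofReal (by linarith), ← ENNReal.ofReal_div_of_pos (by linarith)] at h1
  exact (h1.const_mul c₁).add hα.memLp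

/-- The superposition operator maps `L^p` to the dual exponent. -/
theorem memLp_comp (hα : IsMonotoneSuperposition μ p α c₁ c₂ c₃ c₄) (hp : 1 < p) {U : X → F}
    (hU : MemLp U (ENNReal.ofReal p) μ) :
    MemLp (fun x => α x (U x)) (ENNReal.ofReal (p / (p - 1))) μ := by
  refine (hα.memLp_bound hp hU).mono'
    (aestronglyMeasurable_superposition hα.continuous hα.measurable hU.1) ?_
  filter_upwards [hα.growth] with x hx using hx _

theorem integrable_inner (hα : IsMonotoneSuperposition μ p α c₁ c₂ c₃ c₄) (hp : 1 < p)
    {U W : X → F} (hU : MemLp U (ENNReal.ofReal p) μ) (hW : MemLp W (ENNReal.ofReal p) μ) :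
    Integrable (fun x => ⟪α x (U x), W x⟫_ℝ) μ := by
  have := holderConjugate_ofReal hp
  exact memLp_one_iff_integrable.1
    ((innerSL ℝ : F →L[ℝ] F →L[ℝ] ℝ).memLp_of_bilin 1 (hα.memLp_comp hp hU) hW)

theorem integral_inner_sub_nonneg (hα : IsMonotoneSuperposition μ p α c₁ c₂ c₃ c₄) (hp : 1 < p)
    {U W : X → F} (hU : MemLp U (ENNReal.ofReal p) μ) (hW : MemLp W (ENNReal.ofReal p) μ) :
    0 ≤ ∫ x, ⟪α x (U x), U x - W x⟫_ℝ ∂μ - ∫ x, ⟪α x (W x), U x - W x⟫_ℝ ∂μ := by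
  have hUW : MemLp (fun x => U x - W x) (ENNReal.ofReal p) μ := hU.sub hW
  rw [← integral_sub (hα.integrable_inner hp hU hUW) (hα.integrable_inner hp hW hUW)]
  refine integral_nonneg_of_ae ?_
  filter_upwards [hα.monotone] with x hx
  rw [← inner_sub_left]
  exact hx _ _

theorem le_integral_inner_self (hα : IsMonotoneSuperposition μ p α c₁ c₂ c₃ c₄) (hp : 1 < p)
    {U : X → F} (hU : MemLp U (ENNReal.ofReal p) μ) :
    c₃ * ∫ x, ‖U x‖ ^ p ∂μ - ∫ x, c₄ x ∂μ ≤ ∫ x, ⟪α x (U x), U x⟫_ℝ ∂μ := by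
  have h1 := (integrable_norm_rpow_ofReal (one_pos.trans hp) hU).const_mul c₃
  rw [← integral_const_mul, ← integral_sub h1 hα.integrable]
  refine integral_mono_ae (h1.sub hα.integrable) (hα.integrable_inner hp hU hU) ?_
  filter_upwards [hα.coercive] with x hx using hx _

/-- Hemicontinuity of the superposition operator, by dominated convergence. -/
theorem tendsto_integral_inner (hα : IsMonotoneSuperposition μ p α c₁ c₂ c₃ c₄) (hp : 1 < p)
    {U V W : X → F} (hU : MemLp U (ENNReal.ofReal p) μ) (hV : MemLp V (ENNReal.ofReal p) μ)
    (hW : MemLp W (ENNReal.ofReal p) μ) :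
    Tendsto (fun t : ℝ => ∫ x, ⟪α x (U x + t • V x), W x⟫_ℝ ∂μ) (𝓝[>] 0)
      (𝓝 (∫ x, ⟪α x (U x), W x⟫_ℝ ∂μ)) := by
  have := holderConjugate_ofReal hp
  have hbound : Integrable
      (fun x => (c₁ * ‖‖U x‖ + ‖V x‖‖ ^ (p - 1) + c₂ x) * ‖W x‖) μ := by
    have h1 := hU.norm.add hV.norm
    have h2 := h1.norm_rpow_div (ENNReal.ofReal (p - 1))
    rw [ENNReal.toReal_ofReal (by linarith), ← ENNReal.ofReal_div_of_pos (by linarith)] at h2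
    exact MemLp.integrable_mul ((h2.const_mul c₁).add hα.memLp) hW.norm
  refine tendsto_integral_filter_of_dominated_convergence _ ?_ ?_ hbound ?_
  · refine Eventually.of_forall fun t => ?_
    exact (hα.integrable_inner hp (hU.add (hV.const_smul t)) hW).1
  · filter_upwards [Ioo_mem_nhdsGT one_pos] with t ht
    filter_upwards [hα.growth] with x hx
    refine (norm_inner_le_norm _ _).trans ?_
    gcongr
    refine (hx _).trans ?_
    have hp1 : 0 ≤ p - 1 := by linarith
    have hc := hα.c₁_pos
    gcongr
    rw [Real.norm_of_nonneg (by positivity)]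
    refine (norm_add_le _ _).trans ?_
    gcongr
    rw [norm_smul, Real.norm_of_nonneg ht.1.le]
    exact mul_le_of_le_one_left (norm_nonneg _) ht.2.le
  · filter_upwards [hα.continuous] with x hx
    have : Continuous fun t : ℝ => ⟪α x (U x + t • V x), W x⟫_ℝ := by fun_prop
    have h0 := this.tendsto 0
    rw [zero_smul, add_zero] at h0
    exact h0.mono_left nhdsWithin_le_nhds

/-- Solvability of the resolvent equation over a closed subspace `G` of `H × L^p(μ)`. -/
theorem exists_resolvent_eq [FiniteDimensional ℝ F]
    (hα : IsMonotoneSuperposition μ p α c₁ c₂ c₃ c₄) (hp : 1 < p)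
    [Fact (1 ≤ ENNReal.ofReal p)] {H : Type*} [NormedAddCommGroup H] [InnerProductSpace ℝ H]
    [CompleteSpace H] {G : Submodule ℝ (H × Lp F (ENNReal.ofReal p) μ)}
    (hG : IsClosed (G : Set (H × Lp F (ENNReal.ofReal p) μ))) {h : ℝ} (hh : 0 < h) (v : H) :
    ∃ q ∈ G, ∀ r ∈ G, ⟪q.1 - v, r.1⟫_ℝ + h * ∫ x, ⟪α x (q.2 x), r.2 x⟫_ℝ ∂μ = 0 := by
  have := holderConjugate_ofReal hp
  have hp0 : 0 < p := one_pos.trans hp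
  have : Fact (1 ≤ ENNReal.ofReal (p / (p - 1))) :=
    ⟨ENNReal.HolderConjugate.one_le _ (ENNReal.ofReal p)⟩
  let a : H × Lp F (ENNReal.ofReal p) μ → StrongDual ℝ (H × Lp F (ENNReal.ofReal p) μ) := fun q =>
    (innerSL ℝ (q.1 - v)) ∘L ContinuousLinearMap.fst ℝ H _ +
      h • ((innerSL ℝ : F →L[ℝ] F →L[ℝ] ℝ).lpPairing μ (ENNReal.ofReal (p / (p - 1)))
        (ENNReal.ofReal p) ((hα.memLp_comp hp (Lp.memLp q.2)).toLp)) ∘L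
          ContinuousLinearMap.snd ℝ H _
  have ha : ∀ q r, a q r = ⟪q.1 - v, r.1⟫_ℝ + h * ∫ x, ⟪α x (q.2 x), r.2 x⟫_ℝ ∂μ := by
    intro q r
    change ⟪q.1 - v, r.1⟫_ℝ + h * (innerSL ℝ : F →L[ℝ] F →L[ℝ] ℝ).lpPairing μ _ _ _ r.2 = _
    rw [ContinuousLinearMap.lpPairing_eq_integral]
    congr 2
    refine integral_congr_ae ?_
    filter_upwards [(hα.memLp_comp hp (Lp.memLp q.2)).coeFn_toLp] with x hx
    rw [hx]; rfl
  suffices ∃ q ∈ G, ∀ r ∈ G, a q r = 0 by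
    obtain ⟨q, hq, hq'⟩ := this
    exact ⟨q, hq, fun r hr => by rw [← ha]; exact hq' r hr⟩
  refine exists_eq_zero_of_monotone
    (isUniformlyConvexFunctional_energyFunctional (F := F) (μ := μ) (H := H) hp)
    (exists_energyFunctional_le hp0) hG a ?_ ?_ ?_
  · intro q r
    rw [sub_apply, ha, ha]
    have h1 : ∀ s : H × Lp F (ENNReal.ofReal p) μ, ∫ x, ⟪α x (s.2 x), (q - r).2 x⟫_ℝ ∂μ =
        ∫ x, ⟪α x (s.2 x), q.2 x - r.2 x⟫_ℝ ∂μ := by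
      intro s
      refine integral_congr_ae ?_
      filter_upwards [Lp.coeFn_sub q.2 r.2] with x hx
      rw [Prod.snd_sub, hx, Pi.sub_apply]
    have h2 := hα.integral_inner_sub_nonneg hp (Lp.memLp q.2) (Lp.memLp r.2)
    rw [h1 q, h1 r]
    have h3 : ⟪q.1 - v, (q - r).1⟫_ℝ - ⟪r.1 - v, (q - r).1⟫_ℝ = ‖q.1 - r.1‖ ^ 2 := by
      rw [← inner_sub_left, sub_sub_sub_cancel_right, Prod.fst_sub, real_inner_self_eq_norm_sq]
    have h4 := mul_nonneg hh.le h2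
    have h5 := sq_nonneg ‖q.1 - r.1‖
    linarith
  · intro q r s
    simp only [ha]
    refine Tendsto.add ?_ (Tendsto.const_mul h ?_)
    · have : Continuous fun t : ℝ => ⟪(q + t • r).1 - v, s.1⟫_ℝ := by
        simp only [Prod.fst_add, Prod.smul_fst]
        fun_prop
      have h0 := this.tendsto 0
      rw [zero_smul, add_zero] at h0
      exact h0.mono_left nhdsWithin_le_nhds
    · refine (hα.tendsto_integral_inner hp (Lp.memLp q.2) (Lp.memLp r.2) (Lp.memLp s.2)).congr ?_
      intro t
      refine integral_congr_ae ?_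
      filter_upwards [Lp.coeFn_add q.2 (t • r.2), Lp.coeFn_smul t r.2] with x h1 h2
      rw [Prod.snd_add, Prod.smul_snd, h1, Pi.add_apply, h2, Pi.smul_apply]
  · -- coercivity of `‖u‖² / 2 + h c₃ ‖U‖^p` in the maximum norm
    set K := ‖v‖ ^ 2 / 2 + h * |∫ x, c₄ x ∂μ| + 1 with hK
    have hK0 : 0 < K := by positivity
    have hc₃ := hα.c₃_pos
    refine ⟨max (√(2 * K)) ((K / (h * c₃)) ^ p⁻¹), fun q hq => ?_⟩
    rw [ha]
    have h1 := hα.le_integral_inner_self hp (Lp.memLp q.2)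
    rw [← norm_rpow_eq_integral hp0] at h1
    have h2 := mul_le_mul_of_nonneg_left h1 hh.le
    have h3 : ‖q.1‖ ^ 2 / 2 - ‖v‖ ^ 2 / 2 ≤ ⟪q.1 - v, q.1⟫_ℝ := by
      have := real_inner_le_norm v q.1
      rw [inner_sub_left, real_inner_self_eq_norm_sq]
      nlinarith [sq_nonneg (‖v‖ - ‖q.1‖)]
    have h4 := mul_le_mul_of_nonneg_left (le_abs_self (∫ x, c₄ x ∂μ)) hh.le
    have h5 : K ≤ ‖q.1‖ ^ 2 / 2 + h * c₃ * ‖q.2‖ ^ p := by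
      rcases le_max_iff.1 (show max _ _ ≤ max ‖q.1‖ ‖q.2‖ from hq) with h6 | h6
      · have h7 := (Real.sqrt_le_left (norm_nonneg _)).1 ((le_max_left _ _).trans h6)
        have : 0 ≤ h * c₃ * ‖q.2‖ ^ p := by positivity
        linarith
      · have h7 := Real.rpow_le_rpow (by positivity) ((le_max_right _ _).trans h6) hp0.le
        rw [Real.rpow_inv_rpow (by positivity) hp0.ne', div_le_iff₀ (by positivity)] at h7
        have := sq_nonneg ‖q.1‖
        linarith
    have h8 : h * (c₃ * ‖q.2‖ ^ p - ∫ x, c₄ x ∂μ) = h * c₃ * ‖q.2‖ ^ p - h * ∫ x, c₄ x ∂μ := by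
      ring
    linarith

end IsMonotoneSuperposition

end Superposition

/-! ### The Friedrich extension is m-dissipative -/

section Friedrich

theorem representedBy_density {d k : ℕ} {Ω : Opens (EuclideanSpace ℝ (Fin d))} {H : Type*}
    {μ : Measure (EuclideanSpace ℝ (Fin d))} {p : ℝ} {T : H → Fin k → 𝓓(Ω, ℝ) → ℝ}
    {u : H} (hu : u ∈ energySpace μ p T) :
    RepresentedBy μ p (T u) (density μ p T u) :=
  Classical.epsilon_spec hu

variable {d k : ℕ} {Ω : Opens (EuclideanSpace ℝ (Fin d))} {H : Type*} [NormedAddCommGroup H]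
  [InnerProductSpace ℝ H] {μ : Measure (EuclideanSpace ℝ (Fin d))} {p : ℝ}
  {T : H → Fin k → 𝓓(Ω, ℝ) → ℝ}
  {α : EuclideanSpace ℝ (Fin d) → EuclideanSpace ℝ (Fin k) → EuclideanSpace ℝ (Fin k)}

/-- The monotone field on `Ω`, for a measure `μ` dominated by Lebesgue measure on `Ω`. Continuity
makes the exceptional null sets for monotonicity and coercivity independent of the arguments. -/
theorem IsMonotoneField.exists_isMonotoneSuperposition (hα : IsMonotoneField Ω p α) (hp : 1 < p)
    (hμ : μ ≤ volume.restrict Ω) :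
    ∃ c₁ c₂ c₃ c₄, IsMonotoneSuperposition μ p α c₁ c₂ c₃ c₄ := by
  obtain ⟨c₁, c₂, hc₁, hc₂, -, hgrowth⟩ := hα.growth
  obtain ⟨c₃, c₄, hc₃, hc₄, hcoer⟩ := hα.coercive
  have hae := ae_mono hμ
  have hmono : ∀ᵐ x ∂volume.restrict (Ω : Set (EuclideanSpace ℝ (Fin d))), ∀ i j,
      0 ≤ ⟪α x (denseSeq _ i) - α x (denseSeq _ j), denseSeq _ i - denseSeq _ j⟫_ℝ :=
    ae_all_iff.2 fun i => ae_all_iff.2 fun j => hα.monotone _ _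
  have hcoer' : ∀ᵐ x ∂volume.restrict (Ω : Set (EuclideanSpace ℝ (Fin d))), ∀ i,
      c₃ * ‖denseSeq (EuclideanSpace ℝ (Fin k)) i‖ ^ p - c₄ x ≤
        ⟪α x (denseSeq _ i), denseSeq _ i⟫_ℝ :=
    ae_all_iff.2 fun i => hcoer _
  refine ⟨c₁, c₂, c₃, c₄, hae hα.continuous,
    fun z => ((hα.measurable z).mono_measure hμ).aestronglyMeasurable, hc₁, hc₂.mono_measure hμ,
    hae hgrowth, hae ?_, hc₃, hc₄.mono_measure hμ, hae ?_⟩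
  · filter_upwards [hα.continuous, hmono] with x hx hm z z'
    refine (denseRange_denseSeq (EuclideanSpace ℝ (Fin k))).induction_on₂
      (p := fun z z' => 0 ≤ ⟪α x z - α x z', z - z'⟫_ℝ) ?_ hm z z'
    refine isClosed_le continuous_const ?_
    fun_prop
  · filter_upwards [hα.continuous, hcoer'] with x hx hm z
    refine (denseRange_denseSeq (EuclideanSpace ℝ (Fin k))).induction_on
      (p := fun z => c₃ * ‖z‖ ^ p - c₄ x ≤ ⟪α x z, z⟫_ℝ) z ?_ hm
    have : Continuous fun z : EuclideanSpace ℝ (Fin k) => ‖z‖ ^ p :=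
      continuous_norm.rpow_const fun _ => Or.inr (one_pos.trans hp).le
    refine isClosed_le ?_ ?_ <;> fun_prop

/-- The forms `u ↦ T u j φ` are continuous and linear on `H`. -/
def IsContinuousLinearFamily (T : H → Fin k → 𝓓(Ω, ℝ) → ℝ) : Prop :=
  ∀ j φ, ∃ L : H →L[ℝ] ℝ, ∀ u, T u j φ = L u

/-- Integration of the `j`-th component against a test function is a continuous linear form. -/
theorem exists_Lp_testForm [IsFiniteMeasure μ] (hp : 1 < p) [Fact (1 ≤ ENNReal.ofReal p)]
    (j : Fin k) (φ : 𝓓(Ω, ℝ)) :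
    ∃ L : Lp (EuclideanSpace ℝ (Fin k)) (ENNReal.ofReal p) μ →L[ℝ] ℝ,
      ∀ U, L U = ∫ x, U x j * φ x ∂μ := by
  have := holderConjugate_ofReal hp
  have : Fact (1 ≤ ENNReal.ofReal (p / (p - 1))) :=
    ⟨ENNReal.HolderConjugate.one_le _ (ENNReal.ofReal p)⟩
  have hφ : MemLp (fun x => φ x • EuclideanSpace.single j (1 : ℝ))
      (ENNReal.ofReal (p / (p - 1))) μ :=
    (φ.contDiff.continuous.smul continuous_const).memLp_of_hasCompactSupport
      φ.hasCompactSupport.smul_right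
  refine ⟨(innerSL ℝ : EuclideanSpace ℝ (Fin k) →L[ℝ] _ →L[ℝ] ℝ).lpPairing μ _ _ hφ.toLp,
    fun U => ?_⟩
  rw [ContinuousLinearMap.lpPairing_eq_integral]
  refine integral_congr_ae ?_
  filter_upwards [hφ.coeFn_toLp] with x hx
  rw [hx]
  change ⟪φ x • EuclideanSpace.single j (1 : ℝ), U x⟫_ℝ = _
  rw [real_inner_smul_left, EuclideanSpace.inner_single_left]
  simp [mul_comm]

/-- The graph of `u ↦ T u` in `H × L^p(μ)^k` is a closed subspace. -/
theorem exists_energyGraph [IsFiniteMeasure μ] (hp : 1 < p) [Fact (1 ≤ ENNReal.ofReal p)]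
    (hT : IsContinuousLinearFamily T) :
    ∃ G : Submodule ℝ (H × Lp (EuclideanSpace ℝ (Fin k)) (ENNReal.ofReal p) μ),
      IsClosed (G : Set (H × Lp (EuclideanSpace ℝ (Fin k)) (ENNReal.ofReal p) μ)) ∧
        ∀ q, q ∈ G ↔ RepresentedBy μ p (T q.1) q.2 := by
  choose L hL using hT
  choose M hM using fun j (φ : 𝓓(Ω, ℝ)) => exists_Lp_testForm (μ := μ) hp j φ
  let N := fun j φ => (L j φ) ∘L ContinuousLinearMap.fst ℝ H _ -
    (M j φ) ∘L ContinuousLinearMap.snd ℝ H _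
  refine ⟨⨅ j, ⨅ φ, LinearMap.ker (N j φ).toLinearMap, ?_, fun q => ?_⟩
  · simp only [Submodule.coe_iInf]
    exact isClosed_iInter fun j => isClosed_iInter fun φ => (N j φ).isClosed_ker
  · simp only [Submodule.mem_iInf, LinearMap.mem_ker]
    have h1 : ∀ j φ, N j φ q = T q.1 j φ - ∫ x, q.2 x j * φ x ∂μ := fun j φ => by
      rw [hL, ← hM]; rfl
    constructor
    · exact fun h => ⟨Lp.memLp _, fun j φ => sub_eq_zero.1 ((h1 j φ).symm.trans (h j φ))⟩
    · exact fun h j φ => (h1 j φ).trans (sub_eq_zero.2 (h.2 j φ))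

theorem RepresentedBy.integrable_mul [IsFiniteMeasure μ] (hp : 1 < p) {S : Fin k → 𝓓(Ω, ℝ) → ℝ}
    {v : EuclideanSpace ℝ (Fin d) → EuclideanSpace ℝ (Fin k)} (hv : RepresentedBy μ p S v)
    (j : Fin k) (φ : 𝓓(Ω, ℝ)) : Integrable (fun x => v x j * φ x) μ := by
  have := (holderConjugate_ofReal hp).symm
  have h1 : MemLp (fun x => v x j) (ENNReal.ofReal p) μ :=
    (EuclideanSpace.proj j : EuclideanSpace ℝ (Fin k) →L[ℝ] ℝ).comp_memLp' hv.1
  have h2 : MemLp (fun x => φ x) (ENNReal.ofReal (p / (p - 1))) μ :=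
    φ.contDiff.continuous.memLp_of_hasCompactSupport φ.hasCompactSupport
  exact MemLp.integrable_mul h1 h2

theorem RepresentedBy.sub [IsFiniteMeasure μ] (hp : 1 < p) (hT : IsContinuousLinearFamily T)
    {u u' : H} {v v' : EuclideanSpace ℝ (Fin d) → EuclideanSpace ℝ (Fin k)}
    (hv : RepresentedBy μ p (T u) v) (hv' : RepresentedBy μ p (T u') v') :
    RepresentedBy μ p (T (u - u')) (fun x => v x - v' x) := by
  refine ⟨hv.1.sub hv'.1, fun j φ => ?_⟩
  obtain ⟨L, hL⟩ := hT j φ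
  rw [hL, map_sub, ← hL, ← hL, hv.2, hv'.2,
    ← integral_sub (hv.integrable_mul hp j φ) (hv'.integrable_mul hp j φ)]
  exact integral_congr_ae (Eventually.of_forall fun x => by simp [sub_mul])

/-- Representatives are unique almost everywhere, by the fundamental lemma of the calculus of
variations. -/
theorem RepresentedBy.ae_eq [IsFiniteMeasure μ] (hμ : μ ≤ volume.restrict Ω) (hp : 1 < p)
    {S : Fin k → 𝓓(Ω, ℝ) → ℝ}
    {v v' : EuclideanSpace ℝ (Fin d) → EuclideanSpace ℝ (Fin k)}
    (hv : RepresentedBy μ p S v) (hv' : RepresentedBy μ p S v') : v =ᵐ[μ] v' := by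
  have hΩ : ∀ᵐ x ∂μ, x ∈ (Ω : Set (EuclideanSpace ℝ (Fin d))) :=
    ae_mono hμ (ae_restrict_mem Ω.isOpen.measurableSet)
  have hp1 : 1 ≤ ENNReal.ofReal p := by simpa using hp.le
  have hj : ∀ j, ∀ᵐ x ∂μ, v x j - v' x j = 0 := by
    intro j
    have hint : Integrable (fun x => v x j - v' x j) μ := by
      have h1 : MemLp (fun x => (v - v') x j) (ENNReal.ofReal p) μ :=
        (EuclideanSpace.proj j : EuclideanSpace ℝ (Fin k) →L[ℝ] ℝ).comp_memLp' (hv.1.sub hv'.1)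
      exact h1.integrable hp1
    have h0 := Ω.isOpen.ae_eq_zero_of_integral_contDiff_smul_eq_zero
      (hint.locallyIntegrable.locallyIntegrableOn _) fun g hg hgc hgs => by
        let φ : 𝓓(Ω, ℝ) := ⟨g, hg, hgc, hgs⟩
        have h2 : ∀ x, g x • (v x j - v' x j) = v x j * φ x - v' x j * φ x := fun x => by
          change g x * _ = v x j * g x - v' x j * g x
          ring
        simp only [h2]
        rw [integral_sub (hv.integrable_mul hp j φ) (hv'.integrable_mul hp j φ), ← hv.2, ← hv'.2,
          sub_self]
    filter_upwards [h0, hΩ] with x h1 h2 using h1 h2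
  filter_upwards [ae_all_iff.2 hj] with x hx
  ext j
  exact sub_eq_zero.1 (hx j)

/-- The energetic form may be computed with any representatives. -/
theorem energyForm_eq {H : Type*} {T : H → Fin k → 𝓓(Ω, ℝ) → ℝ} [IsFiniteMeasure μ]
    (hμ : μ ≤ volume.restrict Ω) (hp : 1 < p) {u w : H}
    {U W : EuclideanSpace ℝ (Fin d) → EuclideanSpace ℝ (Fin k)}
    (hU : RepresentedBy μ p (T u) U) (hW : RepresentedBy μ p (T w) W) :
    energyForm μ p T α u w = ∫ x, ⟪α x (U x), W x⟫_ℝ ∂μ := by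
  refine integral_congr_ae ?_
  filter_upwards [(representedBy_density ⟨U, hU⟩).ae_eq hμ hp hU,
    (representedBy_density ⟨W, hW⟩).ae_eq hμ hp hW] with x h1 h2
  rw [h1, h2]

/-- The Friedrich extension is m-dissipative, by the theorem of Browder and Minty on the graph of
`T`. This covers both `Ω` and the weighted subdomains. -/
theorem isMDissipative_friedrich [CompleteSpace H] [IsFiniteMeasure μ]
    (hμ : μ ≤ volume.restrict Ω) (hp : 1 < p) (hT : IsContinuousLinearFamily T)
    (hα : IsMonotoneField Ω p α) : IsMDissipative (friedrich μ p T α) := by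
  have : Fact (1 ≤ ENNReal.ofReal p) := ⟨by simpa using hp.le⟩
  obtain ⟨c₁, c₂, c₃, c₄, hα⟩ := hα.exists_isMonotoneSuperposition hp hμ
  refine ⟨?_, fun h hh v => ?_⟩
  · rintro ⟨u, z⟩ ⟨hu, huz⟩ ⟨w, y⟩ ⟨hw, hwy⟩
    have hU := representedBy_density hu
    have hW := representedBy_density hw
    have hUW := hU.sub hp hT hW
    have h1 := huz _ ⟨_, hUW⟩
    have h2 := hwy _ ⟨_, hUW⟩
    rw [energyForm_eq hμ hp hU hUW, inner_neg_left] at h1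
    rw [energyForm_eq hμ hp hW hUW, inner_neg_left] at h2
    have h3 := hα.integral_inner_sub_nonneg hp hU.1 hW.1
    rw [h1, h2] at h3
    change ⟪z - y, u - w⟫_ℝ ≤ 0
    rw [inner_sub_left]
    linarith
  · obtain ⟨G, hG, hmem⟩ := exists_energyGraph (μ := μ) hp hT
    obtain ⟨⟨u, U⟩, hq, hq'⟩ := hα.exists_resolvent_eq hp hG hh v
    have hU : RepresentedBy μ p (T u) U := (hmem _).1 hq
    refine ⟨u, h⁻¹ • (u - v), ⟨⟨U, hU⟩, fun w ⟨W, hW⟩ => ?_⟩, ?_⟩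
    · have hW' : RepresentedBy μ p (T w) (hW.1.toLp W) := by
        refine ⟨Lp.memLp _, fun j φ => (hW.2 j φ).trans (integral_congr_ae ?_)⟩
        filter_upwards [hW.1.coeFn_toLp] with x hx
        rw [hx]
      have h1 := hq' (w, hW.1.toLp W) ((hmem _).2 hW')
      rw [energyForm_eq hμ hp hU hW', inner_neg_left, real_inner_smul_left]
      dsimp only at h1 ⊢
      rw [eq_neg_iff_add_eq_zero, ← mul_right_inj' hh.ne', mul_zero, mul_add,
        mul_inv_cancel_left₀ hh.ne', add_comm]
      exact h1
    · rw [smul_inv_smul₀ hh.ne', sub_sub_cancel]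

end Friedrich

/-! ### The decomposition of the vector field -/

section Decomposition

variable {d k s : ℕ} {Ω : Opens (EuclideanSpace ℝ (Fin d))} {H : Type*} [NormedAddCommGroup H]
  [InnerProductSpace ℝ H]

namespace DomainDecomposition

theorem isOpen_sub (𝒟 : DomainDecomposition Ω s) (ℓ : Fin s) : IsOpen (𝒟.sub ℓ) := by
  obtain ⟨r, W, hW, -, h⟩ := 𝒟.sub_components ℓ
  rw [← h]
  exact isOpen_iUnion fun i => (hW i).1

theorem sub_subset (𝒟 : DomainDecomposition Ω s) (ℓ : Fin s) : 𝒟.sub ℓ ⊆ Ω := by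
  rw [← 𝒟.iUnion_sub]
  exact subset_iUnion _ ℓ

theorem χ_nonneg (𝒟 : DomainDecomposition Ω s) (ℓ : Fin s) {x : EuclideanSpace ℝ (Fin d)}
    (hx : x ∈ Ω) : 0 ≤ 𝒟.χ ℓ x := by
  by_cases h : x ∈ 𝒟.sub ℓ
  · exact (𝒟.pos ℓ x h).le
  · exact (𝒟.zero ℓ x ⟨hx, h⟩).ge

theorem aemeasurable_χ (𝒟 : DomainDecomposition Ω s) (ℓ : Fin s) :
    AEMeasurable (fun x => ENNReal.ofReal (𝒟.χ ℓ x)) (volume.restrict Ω) :=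
  ((𝒟.smooth ℓ).continuousOn.aemeasurable Ω.isOpen.measurableSet).ennreal_ofReal

/-- Since `χ ℓ` vanishes on `Ω` outside of the subdomain, its measure is the one with density `χ ℓ`
on all of `Ω`. -/
theorem measure_eq (𝒟 : DomainDecomposition Ω s) (ℓ : Fin s) :
    𝒟.measure ℓ = (volume.restrict Ω).withDensity fun x => ENNReal.ofReal (𝒟.χ ℓ x) := by
  have hsub : (volume.restrict (𝒟.sub ℓ)) = (volume.restrict Ω).restrict (𝒟.sub ℓ) := by
    rw [Measure.restrict_restrict (𝒟.isOpen_sub ℓ).measurableSet,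
      inter_eq_self_of_subset_left (𝒟.sub_subset ℓ)]
  rw [DomainDecomposition.measure, hsub,
    ← withDensity_indicator (𝒟.isOpen_sub ℓ).measurableSet]
  refine withDensity_congr_ae ?_
  filter_upwards [ae_restrict_mem Ω.isOpen.measurableSet] with x hx
  by_cases h : x ∈ 𝒟.sub ℓ
  · rw [indicator_of_mem h]
  · rw [indicator_of_notMem h, 𝒟.zero ℓ x ⟨hx, h⟩, ENNReal.ofReal_zero]

theorem integral_measure (𝒟 : DomainDecomposition Ω s) (ℓ : Fin s)
    (g : EuclideanSpace ℝ (Fin d) → ℝ) :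
    ∫ x, g x ∂𝒟.measure ℓ = ∫ x in Ω, 𝒟.χ ℓ x * g x := by
  rw [measure_eq, integral_withDensity_eq_integral_toReal_smul₀ (𝒟.aemeasurable_χ ℓ)
    (Eventually.of_forall fun x => ENNReal.ofReal_lt_top)]
  refine integral_congr_ae ?_
  filter_upwards [ae_restrict_mem Ω.isOpen.measurableSet] with x hx
  rw [ENNReal.toReal_ofReal (𝒟.χ_nonneg ℓ hx), smul_eq_mul]

theorem measure_le (𝒟 : DomainDecomposition Ω s) (ℓ : Fin s) :
    𝒟.measure ℓ ≤ volume.restrict Ω := by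
  rw [measure_eq]
  nth_rewrite 2 [← withDensity_one (μ := volume.restrict (Ω : Set (EuclideanSpace ℝ (Fin d))))]
  refine withDensity_mono ?_
  filter_upwards [ae_restrict_mem Ω.isOpen.measurableSet] with x hx
  rw [Pi.one_apply, ENNReal.ofReal_le_one, ← 𝒟.sum_eq_one x hx]
  exact Finset.single_le_sum (fun ℓ _ => 𝒟.χ_nonneg ℓ hx) (Finset.mem_univ ℓ)

theorem integral_eq_sum (𝒟 : DomainDecomposition Ω s) {g : EuclideanSpace ℝ (Fin d) → ℝ}
    (hg : Integrable g (volume.restrict Ω)) : ∫ x in Ω, g x = ∑ ℓ, ∫ x, g x ∂𝒟.measure ℓ := by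
  simp only [integral_measure]
  rw [← integral_finsetSum]
  · refine integral_congr_ae ?_
    filter_upwards [ae_restrict_mem Ω.isOpen.measurableSet] with x hx
    rw [← Finset.sum_mul, 𝒟.sum_eq_one x hx, one_mul]
  · intro ℓ _
    refine hg.bdd_mul (c := 1)
      ((𝒟.smooth ℓ).continuousOn.aestronglyMeasurable Ω.isOpen.measurableSet) ?_
    filter_upwards [ae_restrict_mem Ω.isOpen.measurableSet] with x hx
    rw [Real.norm_of_nonneg (𝒟.χ_nonneg ℓ hx), ← 𝒟.sum_eq_one x hx]
    exact Finset.single_le_sum (fun ℓ _ => 𝒟.χ_nonneg ℓ hx) (Finset.mem_univ ℓ)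

end DomainDecomposition

variable {p : ℝ} {δ : H →ₗ[ℝ] (Fin k → 𝓓'(Ω, ℝ))}
  {α : EuclideanSpace ℝ (Fin d) → EuclideanSpace ℝ (Fin k) → EuclideanSpace ℝ (Fin k)}

theorem SeqContinuousDistr.isContinuousLinearFamily (hδ : SeqContinuousDistr δ) :
    IsContinuousLinearFamily (form δ) := fun j φ =>
  ⟨⟨{ toFun := fun u => δ u j φ
      map_add' := fun u v => by rw [map_add]; rfl
      map_smul' := fun c u => by rw [map_smul]; rfl },
    continuous_iff_seqContinuous.2 fun u a h => hδ u a h j φ⟩, fun _ => rfl⟩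

theorem SeqContinuousDistr.isContinuousLinearFamily_sub (hδ : SeqContinuousDistr δ)
    (𝒟 : DomainDecomposition Ω s) (ℓ : Fin s) : IsContinuousLinearFamily (subForm 𝒟 ℓ δ) :=
  fun j φ => hδ.isContinuousLinearFamily j (mulTest (𝒟.χ ℓ) (𝒟.smooth ℓ) φ)

/-- A representative on `Ω` is also one on each subdomain, so that the energetic space `V` is
contained in the energetic space of the subdomain. -/
theorem RepresentedBy.subForm {u : H} {v : EuclideanSpace ℝ (Fin d) → EuclideanSpace ℝ (Fin k)}
    (hv : RepresentedBy (volume.restrict Ω) p (form δ u) v) (𝒟 : DomainDecomposition Ω s)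
    (ℓ : Fin s) : RepresentedBy (𝒟.measure ℓ) p (DomainSplitting.subForm 𝒟 ℓ δ u) v := by
  refine ⟨hv.1.mono_measure (𝒟.measure_le ℓ), fun j φ => ?_⟩
  rw [𝒟.integral_measure]
  refine (hv.2 j (mulTest (𝒟.χ ℓ) (𝒟.smooth ℓ) φ)).trans (integral_congr_ae ?_)
  refine Eventually.of_forall fun x => ?_
  change v x j * (𝒟.χ ℓ x * φ x) = 𝒟.χ ℓ x * (v x j * φ x)
  ring

/-- On the common domain, the vector field is the sum of the decomposed vector fields. -/
theorem eq_sum_of_mem_subField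
    [IsFiniteMeasure (volume.restrict (Ω : Set (EuclideanSpace ℝ (Fin d))))] (hp : 1 < p)
    (𝒟 : DomainDecomposition Ω s) (hV : Dense (DomainSplitting.V p δ))
    (hα : IsMonotoneField Ω p α) {u z : H} {a : Fin s → H} (hz : (u, z) ∈ field p δ α)
    (ha : ∀ ℓ, (u, a ℓ) ∈ subField p 𝒟 δ α ℓ) : z = ∑ ℓ, a ℓ := by
  obtain ⟨c₁, c₂, c₃, c₄, hα⟩ := hα.exists_isMonotoneSuperposition hp le_rfl
  refine neg_injective (hV.eq_of_inner_left (𝕜 := ℝ) fun w hw => ?_)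
  have hU := representedBy_density hz.1
  have hW := representedBy_density hw
  rw [← hz.2 w hw, energyForm_eq le_rfl hp hU hW,
    𝒟.integral_eq_sum (hα.integrable_inner hp hU.1 hW.1), ← Finset.sum_neg_distrib, sum_inner]
  refine Finset.sum_congr rfl fun ℓ _ => ?_
  have : IsFiniteMeasure (𝒟.measure ℓ) := isFiniteMeasure_of_le _ (𝒟.measure_le ℓ)
  rw [← (ha ℓ).2 w ⟨_, hW.subForm 𝒟 ℓ⟩,
    energyForm_eq (𝒟.measure_le ℓ) hp (hU.subForm 𝒟 ℓ) (hW.subForm 𝒟 ℓ)]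

end Decomposition

end DomainSplitting

end

theorem mainTheorem2 {d k s : ℕ} (hd : 1 ≤ d) (hk : 1 ≤ k)
    (Ω : Opens (EuclideanSpace ℝ (Fin d)))
    (hΩ_conn : IsConnected (Ω : Set (EuclideanSpace ℝ (Fin d))))
    (hΩ_bdd : Bornology.IsBounded (Ω : Set (EuclideanSpace ℝ (Fin d))))
    (p : ℝ) (hp : 1 < p) (𝒟 : DomainDecomposition Ω s)
    {H : Type*} [NormedAddCommGroup H] [InnerProductSpace ℝ H] [CompleteSpace H]
    (δ : H →ₗ[ℝ] (Fin k → 𝓓'(Ω, ℝ))) (hδ : SeqContinuousDistr δ)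
    (hV : Dense (DomainSplitting.V p δ))
    (α : EuclideanSpace ℝ (Fin d) → EuclideanSpace ℝ (Fin k) → EuclideanSpace ℝ (Fin k))
    (hα : IsMonotoneField Ω p α)
    (hrange : ∀ h : ℝ, 0 < h → ∀ v ∈ DomainSplitting.V p δ, ∃ u,
      Solves (restrictTo (field p δ α) (⋂ ℓ, dom (subField p 𝒟 δ α ℓ))) h v u)
    (hdom : Dense (dom (field p δ α))) :
    (∀ h : ℝ, 0 < h → ∀ v : H, (∃! u, Solves (field p δ α) h v u) ∧
      ∀ ℓ, ∃! u, Solves (subField p 𝒟 δ α ℓ) h v u) ∧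
    (∀ η : H, ∀ t : ℝ, 0 < t →
      Tendsto (fun n : ℕ => (resolventMap (field p δ α) (t / n))^[n] η) atTop
        (𝓝 (expMap (field p δ α) t η))) ∧
    ∀ (η : H) (T : ℝ),
      TendstoUniformlyOn (fun (n : ℕ) (t : ℝ) => (lieStep (subField p 𝒟 δ α) (t / n))^[n] η)
        (fun t => expMap (field p δ α) t η) atTop (Ioo 0 T) := by
  have hfin : IsFiniteMeasure (volume.restrict (Ω : Set (EuclideanSpace ℝ (Fin d)))) :=
    ⟨by rw [Measure.restrict_apply_univ]; exact hΩ_bdd.measure_lt_top⟩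
  have hf : IsMDissipative (field p δ α) :=
    isMDissipative_friedrich le_rfl hp hδ.isContinuousLinearFamily hα
  have hfsub : ∀ ℓ, IsMDissipative (subField p 𝒟 δ α ℓ) := fun ℓ => by
    have : IsFiniteMeasure (𝒟.measure ℓ) := isFiniteMeasure_of_le _ (𝒟.measure_le ℓ)
    exact isMDissipative_friedrich (𝒟.measure_le ℓ) hp (hδ.isContinuousLinearFamily_sub 𝒟 ℓ) hα
  refine ⟨fun h hh v => ⟨hf.existsUnique hh v, fun ℓ => (hfsub ℓ).existsUnique hh v⟩,
    fun η t ht => hf.tendsto_expMap hdom ht η,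
    fun η T => hf.tendstoUniformlyOn_lieStep hdom hfsub hV ?_ η T⟩
  intro l hl x hx
  obtain ⟨u, z, ⟨huz, hu⟩, hux⟩ := hrange l hl x hx
  choose a ha using mem_iInter.1 hu
  have hza := eq_sum_of_mem_subField hp 𝒟 hV hα huz ha
  rw [hza] at huz hux
  exact ⟨u, a, ha, huz, hux⟩
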